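/- Indices run over $1,2,3$, repeated indices are summed, and $S_2(\mathbb R^3)$ is the space of real symmetric $3\times3$ matrices. Let $\Lambda\in\mathbb R$ (cosmological constant). For a positive definite $a_{ij}$ with determinant $a$, a symmetric $b^{ij}$, $h\in\mathbb R^3$ and $f:\mathbb R^3\to\mathbb R$ put $$\Psi_{i_1\cdots i_n}=\frac{4\pi}{\sqrt a}\int_{\mathbb R^3}(b^{kl}p_kp_l)^{-\frac{n-1}2}p_{i_1}\cdots p_{i_n}f(p)\,d^3p,$$ $$\delta^{mn}_{ij}=\delta^{(m}_i\delta^{n)}_j,\quad \pi^{mn}_{ij}=\tfrac13a_{ij}b^{mn},\quad \chi^{pq}_{ij}=b^{mp}b^{nq}\Psi_{ijmn},\quad \Pi^{mn}_{ij}=\Psi_{ij}b^{mn},\quad \mathcal M^{mn}_{ij}=a_{ip}a_{jq}\mathcal M^{pqmn},$$ $$\mathcal M^{pqrs}=\frac2a\Big(b^{pq}h^rh^s+2b^{rs}h^ph^q+\tfrac12(a_{mn}h^mh^n)(b^{pr}b^{qs}+b^{ps}b^{qr}-2b^{pq}b^{rs})-b^{qr}h^ph^s-b^{pr}h^qh^s-b^{qs}h^ph^r-b^{ps}h^qh^r\Big).$$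 The rescaled Einstein--Vlasov system with a magnetic field and Bianchi I symmetry, for the unknowns $a_{ij},b^{ij},k_{ij},Z_{ij},f$ with $a_{ij}$ positive definite, is $\partial_\tau f=0$ together with $$\frac{da_{ij}}{d\tau}=k_{ij},\qquad \frac{db^{ij}}{d\tau}=-b^{im}b^{jn}k_{mn},$$ $$\frac{dk_{ij}}{d\tau}=-\Big(\frac2\tau+\frac{b^{mn}k_{mn}}2\Big)k_{ij}+\frac2\tau Z_{ij}-\frac3\tau\pi^{mn}_{ij}k_{mn}+k_{im}b^{mn}k_{nj}+2\Lambda\tau^2a_{ij},$$ $$\frac{dZ_{ij}}{d\tau}=\frac1\tau\big(-Z_{ij}-k_{ij}+\chi^{mn}_{ij}k_{mn}-\Pi^{mn}_{ij}k_{mn}\big)+\frac2{a\tau}\Big[a_{ij}h^mh^n+a_{rs}\delta^{mn}_{ij}h^rh^s-2a_{ir}\delta^m_jh^rh^n-2a_{jr}\delta^m_ih^rh^n+(2a_{ir}a_{js}-a_{ij}a_{rs})b^{mn}h^rh^s\Big]k_{mn}.$$ **Theorem.** Let $a_0,b_0,k_0,Z_0\in S_2(\mathbb R^3)$ with $a_0$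 positive definite and $b_0=a_0^{-1}$, let $h\in\mathbb R^3$, and let $f_0\ge0$ be a smooth function with compact support in $\mathbb R^3\setminus\{0\}$ that is not identically zero. Suppose that these data, at $\tau=0$, satisfy the Fuchsian conditions $$2\Psi_{ij}=a_{ij}-\frac2a(a_{ij}a_{mn}-2a_{im}a_{jn})h^mh^n,$$ $$(2\delta^{mn}_{ij}+3\pi^{mn}_{ij})k_{mn}-2\delta^{mn}_{ij}Z_{mn}=0,\qquad(\delta^{mn}_{ij}-\chi^{mn}_{ij}+\Pi^{mn}_{ij}-\mathcal M^{mn}_{ij})k_{mn}+\delta^{mn}_{ij}Z_{mn}=0,$$ and the constraints $$\int f_0\,p_i\,d^3p=0,\qquad 0=3-\frac2aa_{ij}h^ih^j-\frac{8\pi}{\sqrt a}\int f_0\,(b^{mn}p_mp_n)^{1/2}d^3p.$$ Then there is $T>0$ such that the rescaled Einstein--Vlasov system has exactly one solution on $[0,T]$ with $a,b,k,Z\in C^0([0,T];S_2(\mathbb R^3))$ and $f\in C^1([0,T];L^1(\mathbb R^3))$ taking the values $a_0,b_0,k_0,Z_0,f_0$ at $\tau=0$, where the equations for $a,b,k,Z$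 are required on $(0,T]$ and $\partial_\tau f=0$ on $[0,T]$; for this solution $b=a^{-1}$ on $[0,T]$. If in addition $(a_0)_{ij}h^ih^j<\frac16$, or $(a_0)_{ij}h^ih^j<\frac16\det a_0$, then $a,b,k,Z\in C^1([0,T];S_2(\mathbb R^3))$. -/

import Mathlib

open Set MeasureTheory
open scoped ContDiff

noncomputable section

namespace RescaledEV

/-- Components of a rank-two tensor on the three-dimensional spatial slice. -/
abbrev Mat3 := Matrix (Fin 3) (Fin 3) ℝ

/-- Momentum space: the covariant components `p = (p_1, p_2, p_3)`, with Lebesgue measure `d³p`. -/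
abbrev Mom := Fin 3 → ℝ

/-- Components `T i j m n = T_{ij}^{mn}` (or `T^{ijmn}`) of a rank-four tensor. -/
abbrev Tensor4 := Fin 3 → Fin 3 → Fin 3 → Fin 3 → ℝ

/-- `T_{ij}^{mn} k_{mn}`. -/
def contr (T : Tensor4) (k : Mat3) (i j : Fin 3) : ℝ := ∑ m, ∑ n, T i j m n * k m n

/-- The quadratic form `b^{kl} p_k p_l`; also used for `a_{ij} h^i h^j`. -/
def quad (b : Mat3) (p : Fin 3 → ℝ) : ℝ := ∑ k, ∑ l, b k l * p k * p l

/-- The trace `b^{mn} k_{mn}`. -/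
def tr (b k : Mat3) : ℝ := ∑ m, ∑ n, b m n * k m n

/-- The moment tensor
`Ψ_{i₁…i_n} = (4π/√a) ∫ (b^{kl} p_k p_l)^{-(n-1)/2} p_{i₁} ⋯ p_{i_n} f d³p`, where `a = det (a_{ij})`. -/
def Psi (a b : Mat3) (f : Mom → ℝ) {n : ℕ} (I : Fin n → Fin 3) : ℝ :=
  4 * Real.pi / Real.sqrt a.det *
    ∫ p : Mom, quad b p ^ (-((n : ℝ) - 1) / 2) * (∏ s, p (I s)) * f p

/-- The Kronecker symbol `δ^m_i`. -/
def kron (m i : Fin 3) : ℝ := if m = i then 1 else 0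

/-- `δ_{ij}^{mn} = δ_i^{(m} δ_j^{n)}`. -/
def deltaT : Tensor4 := fun i j m n => (kron m i * kron n j + kron n i * kron m j) / 2

/-- `π_{ij}^{mn} = (1/3) a_{ij} b^{mn}`. -/
def piT (a b : Mat3) : Tensor4 := fun i j m n => 1 / 3 * a i j * b m n

/-- `χ_{ij}^{pq} = b^{mp} b^{nq} Ψ_{ijmn}`. -/
def chiT (a b : Mat3) (f : Mom → ℝ) : Tensor4 := fun i j p q =>
  ∑ m, ∑ n, b m p * b n q * Psi a b f ![i, j, m, n]

/-- `Π_{ij}^{mn} = Ψ_{ij} b^{mn}`. -/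
def PiT (a b : Mat3) (f : Mom → ℝ) : Tensor4 := fun i j m n => Psi a b f ![i, j] * b m n

/-- The magnetic tensor `𝓜^{pqrs}` with all indices raised. -/
def magUp (a b : Mat3) (h : Fin 3 → ℝ) : Tensor4 := fun p q r s =>
  2 / a.det *
    (b p q * h r * h s + 2 * b r s * h p * h q
      + 1 / 2 * quad a h * (b p r * b q s + b p s * b q r - 2 * b p q * b r s)
      - b q r * h p * h s - b p r * h q * h s - b q s * h p * h r - b p s * h q * h r)

/-- `𝓜_{ij}^{mn} = a_{ip} a_{jq} 𝓜^{pqmn}`. -/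
def magT (a b : Mat3) (h : Fin 3 → ℝ) : Tensor4 := fun i j m n =>
  ∑ p, ∑ q, a i p * a j q * magUp a b h p q m n

/-- The bracket that multiplies `(2 / (a τ)) k_{mn}` in the evolution equation of `Z_{ij}`. -/
def magBracket (a b : Mat3) (h : Fin 3 → ℝ) : Tensor4 := fun i j m n =>
  a i j * h m * h n + ∑ r, ∑ s,
    (a r s * deltaT i j m n * h r * h s)
  - (∑ r, a i r * kron m j * h r * h n) - (∑ s, a i s * kron m j * h n * h s)
  - (∑ s, a j s * kron m i * h n * h s) - (∑ r, a j r * kron m i * h r * h n)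
  + ∑ r, ∑ s, (a i r * a j s * b m n + a i s * a j r * b m n - a i j * a r s * b m n) * h r * h s

/-- Right-hand side of `dk_{ij}/dτ`. -/
def kRHS (Λ τ : ℝ) (a b k Z : Mat3) (i j : Fin 3) : ℝ :=
  -(2 / τ + tr b k / 2) * k i j + 2 / τ * Z i j - 3 / τ * contr (piT a b) k i j
    + (∑ m, ∑ n, k i m * b m n * k n j) + 2 * Λ * τ ^ 2 * a i j

/-- Right-hand side of `dZ_{ij}/dτ`. -/
def ZRHS (τ : ℝ) (h : Fin 3 → ℝ) (a b k Z : Mat3) (f : Mom → ℝ) (i j : Fin 3) : ℝ :=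
  1 / τ * (-Z i j - k i j + contr (chiT a b f) k i j - contr (PiT a b f) k i j)
    + 2 / (a.det * τ) * contr (magBracket a b h) k i j

/-- Initial data of the rescaled Einstein-Vlasov system with a magnetic field: symmetric
matrices `a₀, b₀, k₀, Z₀`, with `a₀` a Riemannian metric and `b₀` its inverse; a magnetic field
vector `h`; and a non-negative, not identically zero, smooth distribution function `f₀` with
compact support in `ℝ³ \ {0}`. -/
structure InitialData where
  a : Mat3
  b : Mat3
  k : Mat3
  Z : Mat3
  h : Fin 3 → ℝ
  f : Mom → ℝ
  a_posDef : a.PosDef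
  a_mul_b : a * b = 1
  k_symm : k.IsSymm
  Z_symm : Z.IsSymm
  f_smooth : ContDiff ℝ ∞ f
  f_compact : HasCompactSupport f
  f_support : (0 : Mom) ∉ tsupport f
  f_nonneg : ∀ p, 0 ≤ f p
  f_ne_zero : ∃ p, f p ≠ 0

/-- The Fuchsian conditions at `τ = 0`. -/
structure InitialData.Fuchsian (D : InitialData) : Prop where
  /-- `2 Ψ_{ij} = a_{ij} - (2/a) (a_{ij} a_{mn} - 2 a_{im} a_{jn}) h^m h^n`. -/
  metric : ∀ i j, 2 * Psi D.a D.b D.f ![i, j] = D.a i j - 2 / D.a.det *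
    ∑ m, ∑ n, (D.a i j * D.a m n - 2 * D.a i m * D.a j n) * D.h m * D.h n
  /-- First row of the compatibility condition `N(0, x₀) y₀ = 0`. -/
  compat_k : ∀ i j, 2 * contr deltaT D.k i j + 3 * contr (piT D.a D.b) D.k i j
    - 2 * contr deltaT D.Z i j = 0
  /-- Second row of the compatibility condition `N(0, x₀) y₀ = 0`. -/
  compat_Z : ∀ i j, contr deltaT D.k i j - contr (chiT D.a D.b D.f) D.k i j
    + contr (PiT D.a D.b D.f) D.k i j - contr (magT D.a D.b D.h) D.k i j
    + contr deltaT D.Z i j = 0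

/-- The momentum and Hamiltonian constraints at `τ = 0`. -/
structure InitialData.Constraints (D : InitialData) : Prop where
  momentum : ∀ i, ∫ p : Mom, D.f p * p i = 0
  hamiltonian : 0 = 3 - 2 / D.a.det * quad D.a D.h
    - 8 * Real.pi / Real.sqrt D.a.det * ∫ p : Mom, D.f p * quad D.b p ^ (1 / 2 : ℝ)

/-- The time-dependent unknowns `a_{ij}, b^{ij}, k_{ij}, Z_{ij}, f`. -/
structure Curve where
  a : ℝ → Mat3
  b : ℝ → Mat3
  k : ℝ → Mat3
  Z : ℝ → Mat3
  f : ℝ → Lp ℝ 1 (volume : Measure Mom)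

/-- `S` is a solution on `[0, T]` of the rescaled Einstein-Vlasov system with magnetic field and
cosmological constant `Λ` that takes the initial data `D`: `a, b, k, Z ∈ C⁰([0,T]; S₂(ℝ³))` with
`a` a Riemannian metric, `f ∈ C¹([0,T]; L¹(ℝ³))`, the equations for `a, b, k, Z` (singular at
`τ = 0`) hold on `(0, T]`, and the Vlasov equation holds on `[0, T]`. -/
structure IsSolution (Λ : ℝ) (D : InitialData) (T : ℝ) (S : Curve) : Prop where
  a_cont : ContinuousOn S.a (Icc 0 T)
  b_cont : ContinuousOn S.b (Icc 0 T)
  k_cont : ContinuousOn S.k (Icc 0 T)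
  Z_cont : ContinuousOn S.Z (Icc 0 T)
  a_posDef : ∀ τ ∈ Icc 0 T, (S.a τ).PosDef
  b_symm : ∀ τ ∈ Icc 0 T, (S.b τ).IsSymm
  k_symm : ∀ τ ∈ Icc 0 T, (S.k τ).IsSymm
  Z_symm : ∀ τ ∈ Icc 0 T, (S.Z τ).IsSymm
  f_contDiff : ContDiffOn ℝ 1 S.f (Icc 0 T)
  a_init : S.a 0 = D.a
  b_init : S.b 0 = D.b
  k_init : S.k 0 = D.k
  Z_init : S.Z 0 = D.Z
  f_init : S.f 0 =ᵐ[volume] D.f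
  a_eq : ∀ τ ∈ Ioc 0 T, ∀ i j,
    HasDerivWithinAt (fun t => S.a t i j) (S.k τ i j) (Icc 0 T) τ
  b_eq : ∀ τ ∈ Ioc 0 T, ∀ i j,
    HasDerivWithinAt (fun t => S.b t i j)
      (-∑ m, ∑ n, S.b τ i m * S.b τ j n * S.k τ m n) (Icc 0 T) τ
  k_eq : ∀ τ ∈ Ioc 0 T, ∀ i j,
    HasDerivWithinAt (fun t => S.k t i j)
      (kRHS Λ τ (S.a τ) (S.b τ) (S.k τ) (S.Z τ) i j) (Icc 0 T) τ
  Z_eq : ∀ τ ∈ Ioc 0 T, ∀ i j,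
    HasDerivWithinAt (fun t => S.Z t i j)
      (ZRHS τ D.h (S.a τ) (S.b τ) (S.k τ) (S.Z τ) (S.f τ) i j) (Icc 0 T) τ
  f_eq : ∀ τ ∈ Icc 0 T, HasDerivWithinAt S.f 0 (Icc 0 T) τ

/-- Two curves have the same values on `[0, T]`. -/
def Curve.AgreeOn (S S' : Curve) (T : ℝ) : Prop :=
  ∀ τ ∈ Icc 0 T,
    S.a τ = S'.a τ ∧ S.b τ = S'.b τ ∧ S.k τ = S'.k τ ∧ S.Z τ = S'.Z τ ∧ S.f τ = S'.f τ

/-- `M ∈ C¹([0, T])`, with one-sided derivatives at the endpoints. -/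
def IsC1On (M : ℝ → Mat3) (T : ℝ) : Prop :=
  ∀ i j, ContDiffOn ℝ 1 (fun τ => M τ i j) (Icc 0 T)

end RescaledEV

end

/-! The Vlasov equation makes `f` constant in time, and the equation for `b` keeps `b = a⁻¹`. The
unknowns reduce to `a` and `y = (k, Z)`, which satisfy the Fuchsian system `a' = k`, `τ y' = -N(a) y
+ τ G(τ, a, y)` with `N(a)(k, Z) = (2k + tr(bk) a - 2Z, Lk + Z)` and `L = 1 - χ + Π - 𝓜`.

The singular term is harmless if `N(a₀)` is accretive for some inner product. Write `⟨v, k⟩ = tr(b v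
b k)` on symmetric matrices. The metric Fuchsian condition makes `L` symmetric
(`trace_mul_Lmat_comm`) and nonnegative (`trace_mul_Lmat_nonneg`), with `tr(b Lk) = 2 tr(bk)`
(`trace_Lmat`). Hence `E(k, Z) = ⟨k, Lk⟩ + ⟨k, k⟩ + 2⟨Z, Z⟩` is positive definite, and
`energy_accretive` gives `E(N y, y) ≥ ⟨k, k⟩ + ⟨Z, Z⟩`. So `N(a₀)` is injective, and the
compatibility conditions force `k₀ = Z₀ = 0`.

Accretivity bounds `s^{N(a₀)}` for `0 < s ≤ 1`, so variation of constants solves the equation with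
`N` frozen at `a₀`. Since `a - a₀ = O(τ)`, the error `(N(a) - N(a₀)) y / τ` is regular, and a
contraction yields a solution (`Fuchsian.exists_isSol`). Because `G(0, a₀, 0) = 0`, the solution
satisfies `y = O(τ²)`; then `N(a) y / τ` tends to zero at `τ = 0` and `y` is `C¹` there. Uniqueness
is an exponentially weighted energy estimate for the difference of two solutions
(`Fuchsian.IsSol.unique`). -/

namespace Fuchsian

/-! ### The linear singular equation with constant accretive coefficient. -/

open Filter Topology

variable {E V : Type*} [NormedAddCommGroup E] [NormedSpace ℝ E] [FiniteDimensional ℝ E]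
  [NormedAddCommGroup V] [NormedSpace ℝ V] [FiniteDimensional ℝ V]

/-- A bilinear form `B` that is symmetric, positive definite and for which `A` is accretive. -/
structure IsEnergy (A : E →L[ℝ] E) (B : E →L[ℝ] E →L[ℝ] ℝ) (c : ℝ) : Prop where
  symm : ∀ u v, B u v = B v u
  pos : 0 < c
  coercive : ∀ u, c * ‖u‖ ^ 2 ≤ B u u
  accretive : ∀ u, 0 ≤ B (A u) u

/-- Along `y s = exp (s A) v` the energy `B (y s) (y s)` has derivative `2 B (A y) y ≥ 0`, so it
does not exceed `B v v` at times `t ≤ 0`. Comparing `B` with the norm from both sides produces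
`√(‖B‖ / c)`. -/
theorem IsEnergy.exists_norm_exp_le {A : E →L[ℝ] E} {B : E →L[ℝ] E →L[ℝ] ℝ} {c : ℝ}
    (h : IsEnergy A B c) : ∃ C, 0 ≤ C ∧ ∀ t : ℝ, t ≤ 0 → ‖NormedSpace.exp (t • A)‖ ≤ C := by
  refine ⟨Real.sqrt (‖B‖ / c), Real.sqrt_nonneg _, fun t ht => ?_⟩
  refine ContinuousLinearMap.opNorm_le_bound _ (Real.sqrt_nonneg _) fun v => ?_
  set y : ℝ → E := fun s => NormedSpace.exp (s • A) v with hy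
  have hd : ∀ s, HasDerivAt y (A (y s)) s := fun s => by
    have := (hasDerivAt_exp_smul_const' (𝕂 := ℝ) A s).clm_apply (hasDerivAt_const s v)
    simpa [hy] using this
  have hd2 : ∀ s, HasDerivAt (fun s => B (y s) (y s)) (2 * B (A (y s)) (y s)) s := fun s => by
    have := ((B.hasFDerivAt (x := y s)).comp_hasDerivAt s (hd s)).clm_apply (hd s)
    refine this.congr_deriv ?_
    simp only [Function.comp]
    rw [h.symm (y s) (A (y s))]; ring
  have hmono : Monotone (fun s => B (y s) (y s)) :=
    monotone_of_deriv_nonneg (fun s => (hd2 s).differentiableAt) fun s => by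
      rw [(hd2 s).deriv]; have := h.accretive (y s); linarith
  have h1 : B (y t) (y t) ≤ B v v := by
    have := hmono ht
    simpa [hy] using this
  have h2 : B v v ≤ ‖B‖ * ‖v‖ ^ 2 := by
    have := (le_abs_self _).trans (B.le_opNorm₂ v v)
    linarith [this, sq ‖v‖, mul_assoc ‖B‖ ‖v‖ ‖v‖, congrArg (‖B‖ * ·) (sq ‖v‖)]
  have h3 := h.coercive (y t)
  have hc := h.pos
  have h4 : ‖y t‖ ^ 2 ≤ ‖B‖ / c * ‖v‖ ^ 2 := by
    rw [div_mul_eq_mul_div, le_div_iff₀ hc]; linarith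
  calc ‖y t‖ = Real.sqrt (‖y t‖ ^ 2) := (Real.sqrt_sq (norm_nonneg _)).symm
    _ ≤ Real.sqrt (‖B‖ / c * ‖v‖ ^ 2) := Real.sqrt_le_sqrt h4
    _ = _ := by rw [Real.sqrt_mul (by positivity), Real.sqrt_sq (norm_nonneg _)]

theorem exp_apply_exp_apply (A : E →L[ℝ] E) (s t : ℝ) (v : E) :
    NormedSpace.exp (s • A) (NormedSpace.exp (t • A) v) = NormedSpace.exp ((s + t) • A) v := by
  let _ : NormedAlgebra ℚ (E →L[ℝ] E) := .restrictScalars ℚ ℝ _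
  rw [add_smul, NormedSpace.exp_add_of_commute (((Commute.refl A).smul_left _).smul_right _)]
  rfl

/-- The solution of `τ y' = - A y + τ r` that vanishes at `τ = 0`. -/
noncomputable def sol (A : E →L[ℝ] E) (r : ℝ → E) (τ : ℝ) : E :=
  NormedSpace.exp (-Real.log τ • A) (∫ s in 0..τ, NormedSpace.exp (Real.log s • A) (r s))

section sol

variable {A : E →L[ℝ] E} {C : ℝ}

theorem continuous_exp_smul (A : E →L[ℝ] E) :
    Continuous fun t : ℝ => NormedSpace.exp (t • A) :=
  continuous_iff_continuousAt.2 fun t => (hasDerivAt_exp_smul_const (𝕂 := ℝ) A t).continuousAt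

theorem continuousOn_exp_log (A : E →L[ℝ] E) {r : ℝ → E} (hr : ContinuousOn r (Ioi 0)) :
    ContinuousOn (fun s => NormedSpace.exp (Real.log s • A) (r s)) (Ioi 0) :=
  ((continuous_exp_smul A).comp_continuousOn
    (Real.continuousOn_log.mono fun x hx => (ne_of_gt hx : x ≠ 0))).clm_apply hr

theorem intervalIntegrable_exp_log (hA : ∀ t : ℝ, t ≤ 0 → ‖NormedSpace.exp (t • A)‖ ≤ C)
    {r : ℝ → E} (hr : ContinuousOn r (Ioi 0)) {M τ : ℝ} (h0 : 0 ≤ τ) (h1 : τ ≤ 1)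
    (hM : ∀ s ∈ Ioc 0 τ, ‖r s‖ ≤ M) :
    IntervalIntegrable (fun s => NormedSpace.exp (Real.log s • A) (r s)) volume 0 τ := by
  rw [intervalIntegrable_iff_integrableOn_Ioc_of_le h0]
  have hC : 0 ≤ C := (norm_nonneg _).trans (hA 0 le_rfl)
  refine Integrable.of_bound ?_ (C * M) ?_
  · exact ((continuousOn_exp_log A hr).mono fun x (hx : x ∈ Ioc 0 τ) => hx.1).aestronglyMeasurable
      measurableSet_Ioc
  · refine (ae_restrict_iff' measurableSet_Ioc).2 (Eventually.of_forall fun s hs => ?_)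
    refine (ContinuousLinearMap.le_opNorm _ _).trans ?_
    exact mul_le_mul (hA _ (Real.log_nonpos hs.1.le (hs.2.trans h1))) (hM s hs)
      (norm_nonneg _) hC

/-- Read `exp (log s • A)` as `s^A`. The kernel of `sol` is then `(s/τ)^A` with `s ≤ τ`, whose
exponent `log s - log τ` is nonpositive, so the bound `C` applies uniformly; the factor `τ` is the
length of the interval. -/
theorem norm_sol_le (hA : ∀ t : ℝ, t ≤ 0 → ‖NormedSpace.exp (t • A)‖ ≤ C)
    {r : ℝ → E} (hr : ContinuousOn r (Ioi 0)) {M τ : ℝ} (h0 : 0 ≤ τ) (h1 : τ ≤ 1)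
    (hM : ∀ s ∈ Ioc 0 τ, ‖r s‖ ≤ M) : ‖sol A r τ‖ ≤ C * M * τ := by
  have hC : 0 ≤ C := (norm_nonneg _).trans (hA 0 le_rfl)
  rw [sol, ← ContinuousLinearMap.intervalIntegral_comp_comm _
    (intervalIntegrable_exp_log hA hr h0 h1 hM)]
  refine (intervalIntegral.norm_integral_le_of_norm_le_const (C := C * M) fun s hs => ?_).trans
    (by rw [sub_zero, abs_of_nonneg h0])
  rw [uIoc_of_le h0] at hs
  have h2 : NormedSpace.exp (-Real.log τ • A) (NormedSpace.exp (Real.log s • A) (r s))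
      = NormedSpace.exp ((Real.log s - Real.log τ) • A) (r s) := by
    rw [exp_apply_exp_apply, sub_eq_neg_add]
  rw [h2]
  refine (ContinuousLinearMap.le_opNorm _ _).trans ?_
  refine mul_le_mul (hA _ ?_) (hM s hs) (norm_nonneg _) hC
  have := Real.log_le_log hs.1 hs.2
  linarith

theorem sol_sub (hA : ∀ t : ℝ, t ≤ 0 → ‖NormedSpace.exp (t • A)‖ ≤ C)
    {r r' : ℝ → E} (hr : ContinuousOn r (Ioi 0)) (hr' : ContinuousOn r' (Ioi 0))
    {M M' τ : ℝ} (h0 : 0 ≤ τ) (h1 : τ ≤ 1)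
    (hM : ∀ s ∈ Ioc 0 τ, ‖r s‖ ≤ M) (hM' : ∀ s ∈ Ioc 0 τ, ‖r' s‖ ≤ M') :
    sol A r τ - sol A r' τ = sol A (fun s => r s - r' s) τ := by
  simp only [sol, map_sub]
  rw [intervalIntegral.integral_sub (intervalIntegrable_exp_log hA hr h0 h1 hM)
    (intervalIntegrable_exp_log hA hr' h0 h1 hM'), map_sub]

theorem hasDerivAt_sol (hA : ∀ t : ℝ, t ≤ 0 → ‖NormedSpace.exp (t • A)‖ ≤ C)
    {r : ℝ → E} (hr : ContinuousOn r (Ioi 0)) {M τ : ℝ} (h0 : 0 < τ) (h1 : τ ≤ 1)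
    (hM : ∀ s ∈ Ioc 0 τ, ‖r s‖ ≤ M) :
    HasDerivAt (sol A r) (-(τ⁻¹ • A (sol A r τ)) + r τ) τ := by
  have hc := continuousOn_exp_log A hr
  have hI : HasDerivAt (fun τ => ∫ s in 0..τ, NormedSpace.exp (Real.log s • A) (r s))
      (NormedSpace.exp (Real.log τ • A) (r τ)) τ :=
    intervalIntegral.integral_hasDerivAt_right
      (intervalIntegrable_exp_log hA hr h0.le h1 hM)
      (hc.stronglyMeasurableAtFilter isOpen_Ioi τ h0)
      (hc.continuousAt (Ioi_mem_nhds h0))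
  have hE : HasDerivAt (fun τ => NormedSpace.exp (-Real.log τ • A))
      ((-τ⁻¹) • (A * NormedSpace.exp (-Real.log τ • A))) τ :=
    HasDerivAt.scomp (h := fun τ => -Real.log τ) τ
      (hasDerivAt_exp_smul_const' (𝕂 := ℝ) A (-Real.log τ)) (Real.hasDerivAt_log h0.ne').fun_neg
  refine (hE.clm_apply hI).congr_deriv ?_
  have h2 : NormedSpace.exp (-Real.log τ • A) (NormedSpace.exp (Real.log τ • A) (r τ)) = r τ := by
    rw [exp_apply_exp_apply]
    simp
  rw [h2]
  simp [sol]

theorem continuousOn_sol (hA : ∀ t : ℝ, t ≤ 0 → ‖NormedSpace.exp (t • A)‖ ≤ C)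
    {r : ℝ → E} (hr : ContinuousOn r (Ioi 0)) {M T : ℝ} (h1 : T ≤ 1)
    (hM : ∀ s ∈ Ioc 0 T, ‖r s‖ ≤ M) : ContinuousOn (sol A r) (Icc 0 T) := by
  intro τ hτ
  rcases hτ.1.eq_or_lt with h | h
  · subst h
    have h0 : sol A r 0 = 0 := by simp [sol]
    rw [ContinuousWithinAt, h0]
    refine squeeze_zero_norm' (a := fun τ => C * M * τ) ?_ ?_
    · filter_upwards [self_mem_nhdsWithin] with t ht
      exact norm_sol_le hA hr ht.1 (ht.2.trans h1) fun s hs => hM s ⟨hs.1, hs.2.trans ht.2⟩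
    · have : Tendsto (fun τ => C * M * τ) (𝓝 0) (𝓝 (C * M * 0)) :=
        (continuous_const.mul continuous_id).tendsto 0
      rw [mul_zero] at this
      exact this.mono_left nhdsWithin_le_nhds
  · exact (hasDerivAt_sol hA hr h (hτ.2.trans h1) fun s hs =>
      hM s ⟨hs.1, hs.2.trans hτ.2⟩).continuousAt.continuousWithinAt

end sol

/-! ### Local existence by contraction. -/

/-- `a` and `y` solve `a' = P y`, `τ y' = - N(a) y + τ G(τ, a, y)` on `(0, T]`, are continuous on
`[0, T]`, and start at `a₀` and `0`. -/
structure IsSol (N : V → E →L[ℝ] E) (G : ℝ × V × E → E) (P : E →L[ℝ] V) (a₀ : V) (T : ℝ)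
    (a : ℝ → V) (y : ℝ → E) : Prop where
  a_cont : ContinuousOn a (Icc 0 T)
  y_cont : ContinuousOn y (Icc 0 T)
  a_zero : a 0 = a₀
  y_zero : y 0 = 0
  a_deriv : ∀ τ ∈ Ioc 0 T, HasDerivWithinAt a (P (y τ)) (Icc 0 T) τ
  y_deriv : ∀ τ ∈ Ioc 0 T,
    HasDerivWithinAt y (-(τ⁻¹ • N (a τ) (y τ)) + G (τ, a τ, y τ)) (Icc 0 T) τ

/-- `a₀ + ∫ P w`. -/
noncomputable def pos (P : E →L[ℝ] V) (a₀ : V) (w : ℝ → E) (s : ℝ) : V :=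
  a₀ + ∫ x in 0..s, P (w x)

/-- The regular part of the equation, frozen after time `T`. -/
noncomputable def rem (N : V → E →L[ℝ] E) (G : ℝ × V × E → E) (P : E →L[ℝ] V) (a₀ : V) (T : ℝ)
    (w : ℝ → E) (t : ℝ) : E :=
  -((min t T)⁻¹ • (N (pos P a₀ w (min t T)) - N a₀) (w (min t T)))
    + G (min t T, pos P a₀ w (min t T), w (min t T))

omit [FiniteDimensional ℝ E] [FiniteDimensional ℝ V] in
theorem norm_pos_sub_pos_le {P : E →L[ℝ] V} {a₀ : V} {w w' : ℝ → E} (hw : Continuous w)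
    (hw' : Continuous w') {s d : ℝ} (hs : 0 ≤ s) (hd : ∀ x ∈ Icc 0 s, ‖w x - w' x‖ ≤ d) :
    ‖pos P a₀ w s - pos P a₀ w' s‖ ≤ ‖P‖ * d * s := by
  have h : pos P a₀ w s - pos P a₀ w' s = ∫ x in 0..s, P (w x - w' x) := by
    simp only [pos, add_sub_add_left_eq_sub, map_sub]
    exact (intervalIntegral.integral_sub ((P.continuous.comp hw).intervalIntegrable _ _)
      ((P.continuous.comp hw').intervalIntegrable _ _)).symm
  rw [h]
  refine (intervalIntegral.norm_integral_le_of_norm_le_const (C := ‖P‖ * d) fun x hx => ?_).trans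
    (by rw [sub_zero, abs_of_nonneg hs])
  rw [uIoc_of_le hs] at hx
  exact P.le_opNorm_of_le (hd x ⟨hx.1.le, hx.2⟩)

omit [FiniteDimensional ℝ E] in
theorem hasDerivAt_pos {P : E →L[ℝ] V} {a₀ : V} {w : ℝ → E} (hw : Continuous w) (s : ℝ) :
    HasDerivAt (pos P a₀ w) (P (w s)) s := by
  have := ((P.continuous.comp hw).integral_hasStrictDerivAt 0 s).hasDerivAt
  exact this.const_add a₀

omit [FiniteDimensional ℝ E] in
theorem continuous_pos {P : E →L[ℝ] V} {a₀ : V} {w : ℝ → E} (hw : Continuous w) :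
    Continuous (pos P a₀ w) :=
  continuous_iff_continuousAt.2 fun s => (hasDerivAt_pos hw s).continuousAt

omit [FiniteDimensional ℝ E] [FiniteDimensional ℝ V] in
theorem norm_pos_sub_le {P : E →L[ℝ] V} {a₀ : V} {w : ℝ → E} (hw : Continuous w)
    {s d : ℝ} (hs : 0 ≤ s) (hd : ∀ x ∈ Icc 0 s, ‖w x‖ ≤ d) :
    ‖pos P a₀ w s - a₀‖ ≤ ‖P‖ * d * s := by
  simpa [pos] using norm_pos_sub_pos_le (P := P) (a₀ := a₀) hw (continuous_const (y := (0 : E)))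
    hs (by simpa using hd)

section exist

variable {N : V → E →L[ℝ] E} {G : ℝ × V × E → E} {P : E →L[ℝ] V} {a₀ : V} {T r K : ℝ}

/-- Lipschitz bounds for the coefficients near the initial value, on a time interval that is
short enough. -/
structure Bounds (N : V → E →L[ℝ] E) (G : ℝ × V × E → E) (P : E →L[ℝ] V) (a₀ : V)
    (T r K : ℝ) : Prop where
  T_pos : 0 < T
  T_le_one : T ≤ 1
  T_le : T ≤ r
  PT_le : ‖P‖ * T ≤ r
  K_nonneg : 0 ≤ K
  N_lip : ∀ a, ‖a - a₀‖ ≤ r → ∀ a', ‖a' - a₀‖ ≤ r → ‖N a - N a'‖ ≤ K * ‖a - a'‖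
  G_lip : ∀ τ a y, ‖τ‖ ≤ r → ‖a - a₀‖ ≤ r → ‖y‖ ≤ r →
    ∀ τ' a' y', ‖τ'‖ ≤ r → ‖a' - a₀‖ ≤ r → ‖y'‖ ≤ r →
    ‖G (τ, a, y) - G (τ', a', y')‖ ≤ K * (‖τ - τ'‖ + ‖a - a'‖ + ‖y - y'‖)
  G_zero : G (0, a₀, 0) = 0

namespace Bounds

variable (hb : Bounds N G P a₀ T r K)
include hb

theorem pos_mem {w : ℝ → E} (hw : Continuous w) (hw1 : ∀ s ∈ Icc 0 T, ‖w s‖ ≤ s)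
    {s : ℝ} (hs : s ∈ Icc 0 T) : ‖pos P a₀ w s - a₀‖ ≤ r := by
  refine (norm_pos_sub_le hw hs.1 (d := 1) fun x hx =>
    (hw1 x ⟨hx.1, hx.2.trans hs.2⟩).trans ((hx.2.trans hs.2).trans hb.T_le_one)).trans ?_
  rw [mul_one]
  exact (mul_le_mul_of_nonneg_left hs.2 (norm_nonneg _)).trans hb.PT_le

/-- Integration in time gives `pos - a₀` and `pos - pos'` a factor `t`, which the Lipschitz bound
passes on to `N` and which cancels `t⁻¹`. -/
theorem norm_rem_sub_le {w w' : ℝ → E} (hw : Continuous w) (hw' : Continuous w')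
    (hw1 : ∀ s ∈ Icc 0 T, ‖w s‖ ≤ s) (hw1' : ∀ s ∈ Icc 0 T, ‖w' s‖ ≤ s) {d : ℝ}
    (hd : ∀ s ∈ Icc 0 T, ‖w s - w' s‖ ≤ d) {t : ℝ} (ht : t ∈ Ioc 0 T) :
    ‖rem N G P a₀ T w t - rem N G P a₀ T w' t‖ ≤ (3 * K * (‖P‖ + 1)) * d := by
  have ht' : t ∈ Icc 0 T := ⟨ht.1.le, ht.2⟩
  have hK := hb.K_nonneg
  have h1 := hb.pos_mem hw hw1 ht'
  have h2 := hb.pos_mem hw' hw1' ht'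
  have h3 := norm_pos_sub_pos_le (P := P) (a₀ := a₀) hw hw' ht.1.le
    fun x hx => hd x ⟨hx.1, hx.2.trans ht.2⟩
  have h4 := norm_pos_sub_le (P := P) (a₀ := a₀) hw' ht.1.le (d := 1) fun x hx =>
    (hw1' x ⟨hx.1, hx.2.trans ht.2⟩).trans ((hx.2.trans ht.2).trans hb.T_le_one)
  have hd0 : 0 ≤ d := (norm_nonneg _).trans (hd t ht')
  have ht1 : t ≤ 1 := ht.2.trans hb.T_le_one
  simp only [rem, min_eq_left ht.2]
  set α := pos P a₀ w t
  set α' := pos P a₀ w' t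
  -- The splitting leaves a difference of values of `N`, hence a factor `t`, in each of the two
  -- singular terms.
  have e : -(t⁻¹ • (N α - N a₀) (w t)) + G (t, α, w t)
      - (-(t⁻¹ • (N α' - N a₀) (w' t)) + G (t, α', w' t))
      = -(t⁻¹ • ((N α - N α') (w t) + (N α' - N a₀) (w t - w' t)))
        + (G (t, α, w t) - G (t, α', w' t)) := by
    simp only [sub_apply, map_sub, smul_add, smul_sub]
    abel
  rw [e]
  have hP := norm_nonneg P
  have i1 : ‖(N α - N α') (w t)‖ ≤ K * (‖P‖ * d * t) * 1 := by
    refine (ContinuousLinearMap.le_opNorm _ _).trans ?_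
    refine mul_le_mul ((hb.N_lip _ h1 _ h2).trans (mul_le_mul_of_nonneg_left h3 hK))
      ((hw1 t ht').trans ht1) (norm_nonneg _) ?_
    have := ht.1.le
    positivity
  have i2 : ‖(N α' - N a₀) (w t - w' t)‖ ≤ K * (‖P‖ * 1 * t) * d := by
    refine (ContinuousLinearMap.le_opNorm _ _).trans ?_
    refine mul_le_mul ((hb.N_lip _ h2 _ (by simpa using (norm_nonneg _).trans h1)).trans
      (mul_le_mul_of_nonneg_left h4 hK)) (hd t ht') (norm_nonneg _) ?_
    have := ht.1.le
    positivity
  have hr1 : ‖t‖ ≤ r := by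
    rw [Real.norm_of_nonneg ht.1.le]; exact ht.2.trans hb.T_le
  have i3 : ‖G (t, α, w t) - G (t, α', w' t)‖ ≤ K * (‖P‖ * d * 1 + d) := by
    refine (hb.G_lip _ _ _ hr1 h1 ((hw1 t ht').trans (ht.2.trans hb.T_le)) _ _ _ hr1 h2
      ((hw1' t ht').trans (ht.2.trans hb.T_le))).trans ?_
    refine mul_le_mul_of_nonneg_left ?_ hK
    have := hd t ht'
    have h5 : ‖P‖ * d * t ≤ ‖P‖ * d * 1 := mul_le_mul_of_nonneg_left ht1 (by positivity)
    simp only [sub_self, norm_zero]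
    linarith
  refine (norm_add_le _ _).trans ?_
  rw [norm_neg, norm_smul, Real.norm_of_nonneg (inv_nonneg.2 ht.1.le)]
  have i4 : t⁻¹ * ‖(N α - N α') (w t) + (N α' - N a₀) (w t - w' t)‖ ≤ 2 * (K * ‖P‖ * d) := by
    have := (norm_add_le _ _).trans (add_le_add i1 i2)
    refine (mul_le_mul_of_nonneg_left this (inv_nonneg.2 ht.1.le)).trans (le_of_eq ?_)
    field_simp [ht.1.ne']
    ring
  have : 0 ≤ K * d := mul_nonneg hK hd0
  linarith

/-- Compared with the difference estimate there is one more power of `t`: `w` is itself `O(t)`, and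
`G` vanishes at the initial point. Thus `sol` of the remainder is `O(t²)`. -/
theorem norm_rem_le {w : ℝ → E} (hw : Continuous w)
    (hw1 : ∀ s ∈ Icc 0 T, ‖w s‖ ≤ s) {t : ℝ} (ht : t ∈ Ioc 0 T) :
    ‖rem N G P a₀ T w t‖ ≤ (3 * K * (‖P‖ + 1)) * t := by
  have ht' : t ∈ Icc 0 T := ⟨ht.1.le, ht.2⟩
  have hK := hb.K_nonneg
  have h1 := hb.pos_mem hw hw1 ht'
  have h4 := norm_pos_sub_le (P := P) (a₀ := a₀) hw ht.1.le (d := 1) fun x hx =>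
    (hw1 x ⟨hx.1, hx.2.trans ht.2⟩).trans ((hx.2.trans ht.2).trans hb.T_le_one)
  have ht1 : t ≤ 1 := ht.2.trans hb.T_le_one
  simp only [rem, min_eq_left ht.2]
  set α := pos P a₀ w t
  have hP := norm_nonneg P
  have hr : ‖a₀ - a₀‖ ≤ r := by simpa using (norm_nonneg _).trans h1
  have i2 : ‖(N α - N a₀) (w t)‖ ≤ K * (‖P‖ * 1 * t) * t := by
    refine (ContinuousLinearMap.le_opNorm _ _).trans ?_
    refine mul_le_mul ((hb.N_lip _ h1 _ hr).trans
      (mul_le_mul_of_nonneg_left h4 hK)) (hw1 t ht') (norm_nonneg _) ?_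
    have := ht.1.le
    positivity
  have hr1 : ‖t‖ ≤ r := by
    rw [Real.norm_of_nonneg ht.1.le]; exact ht.2.trans hb.T_le
  have hr0 : 0 ≤ r := (norm_nonneg _).trans h1
  have i3 : ‖G (t, α, w t)‖ ≤ K * (t + ‖P‖ * 1 * t + t) := by
    have := hb.G_lip _ _ _ hr1 h1 ((hw1 t ht').trans (ht.2.trans hb.T_le)) 0 a₀ 0
      (by simpa using hr0) hr (by simpa using hr0)
    rw [hb.G_zero, sub_zero, sub_zero, sub_zero, Real.norm_of_nonneg ht.1.le] at this
    refine this.trans (mul_le_mul_of_nonneg_left ?_ hK)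
    have := hw1 t ht'
    linarith
  refine (norm_add_le _ _).trans ?_
  rw [norm_neg, norm_smul, Real.norm_of_nonneg (inv_nonneg.2 ht.1.le)]
  have i4 : t⁻¹ * ‖(N α - N a₀) (w t)‖ ≤ K * ‖P‖ * t := by
    refine (mul_le_mul_of_nonneg_left i2 (inv_nonneg.2 ht.1.le)).trans (le_of_eq ?_)
    field_simp [ht.1.ne']
  have : 0 ≤ K * t := mul_nonneg hK ht.1.le
  nlinarith [mul_nonneg this hP]

theorem continuousOn_rem {w : ℝ → E} (hw : Continuous w)
    (hw1 : ∀ s ∈ Icc 0 T, ‖w s‖ ≤ s) : ContinuousOn (rem N G P a₀ T w) (Ioi 0) := by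
  have hK := hb.K_nonneg
  have hmin : ContinuousOn (fun t => min t T) (Ioi 0) := by fun_prop
  have hmem : MapsTo (fun t => min t T) (Ioi 0) (Icc 0 T) := fun t ht =>
    ⟨le_min (le_of_lt ht) hb.T_pos.le, min_le_right _ _⟩
  have hN : ContinuousOn N {a | ‖a - a₀‖ ≤ r} :=
    (LipschitzOnWith.of_dist_le_mul (K := K.toNNReal) fun a ha a' ha' => by
      rw [Real.coe_toNNReal _ hK, dist_eq_norm, dist_eq_norm]
      exact hb.N_lip a ha a' ha').continuousOn
  have hG : ContinuousOn G {x | ‖x.1‖ ≤ r ∧ ‖x.2.1 - a₀‖ ≤ r ∧ ‖x.2.2‖ ≤ r} :=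
    (LipschitzOnWith.of_dist_le_mul (K := (K * 3).toNNReal) fun x hx x' hx' => by
      rw [Real.coe_toNNReal _ (by positivity), dist_eq_norm, dist_eq_norm]
      refine (hb.G_lip _ _ _ hx.1 hx.2.1 hx.2.2 _ _ _ hx'.1 hx'.2.1 hx'.2.2).trans ?_
      rw [mul_assoc]
      refine mul_le_mul_of_nonneg_left ?_ hK
      have h1 := norm_fst_le (x - x')
      have h2 := norm_snd_le (x - x')
      have h3 := norm_fst_le (x - x').2
      have h4 := norm_snd_le (x - x').2
      simp only [Prod.fst_sub, Prod.snd_sub] at h1 h2 h3 h4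
      linarith).continuousOn
  have hp : ContinuousOn (fun t => pos P a₀ w (min t T)) (Ioi 0) :=
    (continuous_pos hw).comp_continuousOn hmin
  have hw2 : ContinuousOn (fun t => w (min t T)) (Ioi 0) := hw.comp_continuousOn hmin
  refine ContinuousOn.add (ContinuousOn.neg (ContinuousOn.smul (hmin.inv₀ ?_) ?_)) ?_
  · intro t ht
    exact (lt_min ht hb.T_pos).ne'
  · refine ContinuousOn.clm_apply (ContinuousOn.sub ?_ continuousOn_const) hw2
    exact hN.comp hp fun t ht => hb.pos_mem hw hw1 (hmem ht)
  · refine hG.comp (hmin.prodMk (hp.prodMk hw2)) fun t ht => ⟨?_, ?_, ?_⟩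
    · have := hmem ht
      simp only [Real.norm_eq_abs, abs_of_nonneg this.1]
      exact this.2.trans hb.T_le
    · exact hb.pos_mem hw hw1 (hmem ht)
    · exact (hw1 _ (hmem ht)).trans ((hmem ht).2.trans hb.T_le)

/-- The solution is the fixed point of `w ↦ sol (N a₀) (rem w)`. The map contracts the sup norm by
`C L T ≤ 1/2`, and the quadratic bound on `y` holds with `M = C L`. -/
theorem exists_isSol {C : ℝ} (hA : ∀ t : ℝ, t ≤ 0 → ‖NormedSpace.exp (t • N a₀)‖ ≤ C)
    (hCT : C * (3 * K * (‖P‖ + 1)) * T ≤ 1 / 2) :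
    ∃ a y, IsSol N G P a₀ T a y ∧ (∀ τ ∈ Icc 0 T, ‖a τ - a₀‖ ≤ r) ∧
      ∃ M, ∀ τ ∈ Icc 0 T, ‖y τ‖ ≤ M * τ ^ 2 := by
  have hC : 0 ≤ C := (norm_nonneg _).trans (hA 0 le_rfl)
  have hK := hb.K_nonneg
  set L := 3 * K * (‖P‖ + 1) with hL
  have hL0 : 0 ≤ L := by positivity
  have hT := hb.T_pos
  let S : Set C(Icc (0 : ℝ) T, E) := {u | ∀ t, ‖u t‖ ≤ t}
  have hScl : IsClosed S := by
    simp only [S, ofPred_forall]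
    exact isClosed_iInter fun t => isClosed_le (by fun_prop) continuous_const
  let ext : C(Icc (0 : ℝ) T, E) → ℝ → E := fun u => IccExtend hT.le u
  have hext : ∀ u, Continuous (ext u) := fun u => u.continuous.Icc_extend'
  have hext_eq : ∀ u (t : Icc (0 : ℝ) T), ext u t = u t := fun u t => IccExtend_val _ _ _
  have hext_le : ∀ u ∈ S, ∀ s ∈ Icc 0 T, ‖ext u s‖ ≤ s := fun u hu s hs => by
    have := hu ⟨s, hs⟩
    rwa [← hext_eq] at this
  have hrc := fun u hu => hb.continuousOn_rem (hext u) (hext_le u hu)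
  have hrl := fun u hu t ht => hb.norm_rem_le (hext u) (hext_le u hu) (t := t) ht
  have hrl' : ∀ u ∈ S, ∀ τ ∈ Icc 0 T, ∀ s ∈ Ioc 0 τ, ‖rem N G P a₀ T (ext u) s‖ ≤ L * τ :=
    fun u hu τ hτ s hs => (hrl u hu s ⟨hs.1, hs.2.trans hτ.2⟩).trans
      (mul_le_mul_of_nonneg_left hs.2 hL0)
  have hsol : ∀ u ∈ S, ∀ τ ∈ Icc 0 T,
      ‖sol (N a₀) (rem N G P a₀ T (ext u)) τ‖ ≤ C * L * τ ^ 2 := fun u hu τ hτ =>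
    (norm_sol_le hA (hrc u hu) hτ.1 (hτ.2.trans hb.T_le_one) (hrl' u hu τ hτ)).trans
      (le_of_eq (by ring))
  have hcont : ∀ u ∈ S, ContinuousOn (sol (N a₀) (rem N G P a₀ T (ext u))) (Icc 0 T) :=
    fun u hu => continuousOn_sol hA (hrc u hu) hb.T_le_one (hrl' u hu T ⟨hT.le, le_rfl⟩)
  let F : S → S := fun u =>
    ⟨⟨fun t => sol (N a₀) (rem N G P a₀ T (ext u)) t,
      continuousOn_iff_continuous_domRestrict.1 (hcont u u.2)⟩, fun t => by
        refine (hsol u u.2 t t.2).trans ?_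
        have h1 : C * L * t ≤ 1 :=
          (mul_le_mul_of_nonneg_left t.2.2 (mul_nonneg hC hL0)).trans (by linarith)
        calc C * L * (t : ℝ) ^ 2 = (C * L * t) * t := by ring
          _ ≤ 1 * t := mul_le_mul_of_nonneg_right h1 t.2.1
          _ = t := one_mul _⟩
  have hF : ContractingWith (1 / 2) F := by
    refine ⟨by norm_num, LipschitzWith.of_dist_le_mul fun u v => ?_⟩
    rw [Subtype.dist_eq, Subtype.dist_eq]
    refine (ContinuousMap.dist_le (by positivity)).2 fun t => ?_
    have hd : ∀ s ∈ Icc 0 T, ‖ext u s - ext v s‖ ≤ dist (u : C(Icc (0 : ℝ) T, E)) v :=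
      fun s hs => by
        have := ContinuousMap.dist_apply_le_dist (f := (u : C(Icc (0 : ℝ) T, E))) (g := v) ⟨s, hs⟩
        rwa [dist_eq_norm, ← hext_eq, ← hext_eq] at this
    have ht1 : (t : ℝ) ≤ 1 := t.2.2.trans hb.T_le_one
    have h1 : ‖sol (N a₀) (rem N G P a₀ T (ext u)) t - sol (N a₀) (rem N G P a₀ T (ext v)) t‖
        ≤ C * (L * dist (u : C(Icc (0 : ℝ) T, E)) v) * t := by
      rw [sol_sub hA (hrc u u.2) (hrc v v.2) t.2.1 ht1 (hrl' u u.2 t t.2) (hrl' v v.2 t t.2)]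
      exact norm_sol_le hA ((hrc u u.2).sub (hrc v v.2)) t.2.1 ht1 fun s hs =>
        hb.norm_rem_sub_le (hext u) (hext v) (hext_le u u.2) (hext_le v v.2) hd
          ⟨hs.1, hs.2.trans t.2.2⟩
    rw [dist_eq_norm]
    refine h1.trans ?_
    have h2 : C * L * t ≤ 1 / 2 :=
      (mul_le_mul_of_nonneg_left t.2.2 (mul_nonneg hC hL0)).trans hCT
    calc C * (L * dist (u : C(Icc (0 : ℝ) T, E)) v) * t
        = (C * L * t) * dist (u : C(Icc (0 : ℝ) T, E)) v := by ring
      _ ≤ 1 / 2 * dist (u : C(Icc (0 : ℝ) T, E)) v := mul_le_mul_of_nonneg_right h2 dist_nonneg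
      _ = _ := by norm_num
  have : CompleteSpace S := hScl.completeSpace_coe
  have : Nonempty S := ⟨⟨0, fun t => by simpa using t.2.1⟩⟩
  obtain ⟨u, hu⟩ : ∃ u, F u = u := ⟨_, hF.fixedPoint_isFixedPt⟩
  set w := ext u with hw
  have hwy : ∀ t ∈ Icc 0 T, sol (N a₀) (rem N G P a₀ T w) t = w t := fun t ht => by
    have h1 := congrArg (fun v : S => (v : C(Icc (0 : ℝ) T, E)) ⟨t, ht⟩) hu
    rw [hw, hext_eq u ⟨t, ht⟩, ← h1]
    rfl
  refine ⟨pos P a₀ w, sol (N a₀) (rem N G P a₀ T w), ⟨(continuous_pos (hext u)).continuousOn,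
    hcont u u.2, by simp [pos], by simp [sol], fun τ hτ => ?_, fun τ hτ => ?_⟩,
    fun τ hτ => hb.pos_mem (hext u) (hext_le u u.2) hτ, C * L, hsol u u.2⟩
  · rw [hwy τ ⟨hτ.1.le, hτ.2⟩]
    exact (hasDerivAt_pos (hext u) τ).hasDerivWithinAt
  · have h1 := hasDerivAt_sol hA (hrc u u.2) hτ.1 (hτ.2.trans hb.T_le_one)
      (hrl' u u.2 τ ⟨hτ.1.le, hτ.2⟩)
    refine h1.hasDerivWithinAt.congr_deriv ?_
    rw [hwy τ ⟨hτ.1.le, hτ.2⟩, rem, min_eq_left hτ.2]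
    simp only [sub_apply, smul_sub]
    abel

end Bounds

/-- Local existence for a Fuchsian system. -/
theorem exists_isSol {B : E →L[ℝ] E →L[ℝ] ℝ} {c : ℝ} (hN : ContDiffAt ℝ 1 N a₀)
    (hG : ContDiffAt ℝ 1 G (0, a₀, 0)) (hG0 : G (0, a₀, 0) = 0) (hB : IsEnergy (N a₀) B c)
    {U : Set V} (hU : U ∈ 𝓝 a₀) :
    ∃ T, 0 < T ∧ ∃ a y, IsSol N G P a₀ T a y ∧ (∀ τ ∈ Icc 0 T, a τ ∈ U) ∧
      ∃ M, ∀ τ ∈ Icc 0 T, ‖y τ‖ ≤ M * τ ^ 2 := by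
  obtain ⟨C, hC0, hC⟩ := hB.exists_norm_exp_le
  obtain ⟨K₁, s₁, hs₁, h1⟩ := hN.exists_lipschitzOnWith
  obtain ⟨K₂, s₂, hs₂, h2⟩ := hG.exists_lipschitzOnWith
  obtain ⟨r₁, hr₁, hb₁⟩ := Metric.nhds_basis_closedBall.mem_iff.1 (inter_mem hs₁ hU)
  obtain ⟨r₂, hr₂, hb₂⟩ := Metric.nhds_basis_closedBall.mem_iff.1 hs₂
  set r := min r₁ r₂ with hr
  have hr0 : 0 < r := lt_min hr₁ hr₂
  set K : ℝ := K₁ + K₂ with hK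
  have hK0 : 0 ≤ K := by positivity
  set D := C * (3 * K * (‖P‖ + 1)) with hD
  have hD0 : 0 ≤ D := by positivity
  -- The term `r / (‖P‖ + 1)` keeps `‖P‖ T ≤ r`, and `1 / (2 (D + 1))` makes the contraction
  -- constant `D T` at most `1/2`.
  set T := min (min 1 r) (min (r / (‖P‖ + 1)) (1 / (2 * (D + 1)))) with hT
  have hP := norm_nonneg P
  have hT0 : 0 < T := by positivity
  have hb : Bounds N G P a₀ T r K := by
    refine ⟨hT0, (min_le_left _ _).trans (min_le_left _ _),
      (min_le_left _ _).trans (min_le_right _ _), ?_, hK0, fun a ha a' ha' => ?_,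
      fun τ a y hτ ha hy τ' a' y' hτ' ha' hy' => ?_, hG0⟩
    · have : T ≤ r / (‖P‖ + 1) := (min_le_right _ _).trans (min_le_left _ _)
      rw [le_div_iff₀ (by positivity)] at this
      nlinarith
    · have := h1.dist_le_mul a (hb₁ (by simpa [dist_eq_norm] using ha.trans (min_le_left _ _))).1
        a' (hb₁ (by simpa [dist_eq_norm] using ha'.trans (min_le_left _ _))).1
      rw [dist_eq_norm, dist_eq_norm] at this
      refine this.trans (mul_le_mul_of_nonneg_right ?_ (norm_nonneg _))
      simp [hK]
    · have hm : ∀ τ a y, ‖τ‖ ≤ r → ‖a - a₀‖ ≤ r → ‖y‖ ≤ r → ((τ, a, y) : ℝ × V × E) ∈ s₂ := by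
        intro τ a y hτ ha hy
        refine hb₂ ?_
        simp only [Metric.mem_closedBall, dist_eq_norm, Prod.mk_sub_mk, sub_zero, Prod.norm_mk,
          sup_le_iff]
        exact ⟨hτ.trans (min_le_right _ _), ha.trans (min_le_right _ _),
          hy.trans (min_le_right _ _)⟩
      have := h2.dist_le_mul _ (hm τ a y hτ ha hy) _ (hm τ' a' y' hτ' ha' hy')
      rw [dist_eq_norm, dist_eq_norm] at this
      refine this.trans (mul_le_mul (by simp [hK]) ?_ (norm_nonneg _) hK0)
      simp only [Prod.mk_sub_mk, Prod.norm_mk, sup_le_iff]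
      have := norm_nonneg (τ - τ')
      have := norm_nonneg (a - a')
      have := norm_nonneg (y - y')
      exact ⟨by linarith, by linarith, by linarith⟩
  obtain ⟨a, y, hs, hr, hM⟩ := hb.exists_isSol hC (by
    have h3 : T ≤ 1 / (2 * (D + 1)) := (min_le_right _ _).trans (min_le_right _ _)
    rw [le_div_iff₀ (by positivity)] at h3
    nlinarith)
  exact ⟨T, hT0, a, y, hs, fun τ hτ => (hb₁ (by
    simpa [dist_eq_norm] using (hr τ hτ).trans (min_le_left _ _))).2, hM⟩

end exist

/-! ### Uniqueness by a weighted energy estimate. -/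

/-- The equations are not imposed at `τ = 0`; the fundamental theorem of calculus needs only
interior derivatives and continuity at the ends. -/
theorem norm_le_of_hasDerivWithinAt {F : Type*} [NormedAddCommGroup F] [NormedSpace ℝ F]
    [CompleteSpace F] {T : ℝ} {f f' : ℝ → F} (hf : ContinuousOn f (Icc 0 T)) (h0 : f 0 = 0)
    (hf' : ContinuousOn f' (Icc 0 T))
    (hd : ∀ τ ∈ Ioc 0 T, HasDerivWithinAt f (f' τ) (Icc 0 T) τ) {τ M : ℝ} (hτ : τ ∈ Icc 0 T)
    (hM : ∀ s ∈ Icc 0 τ, ‖f' s‖ ≤ M) : ‖f τ‖ ≤ M * τ := by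
  have hsub : Icc 0 τ ⊆ Icc 0 T := Icc_subset_Icc_right hτ.2
  have h := intervalIntegral.integral_eq_sub_of_hasDerivAt_of_le hτ.1 (hf.mono hsub)
    (fun x hx => (hd x ⟨hx.1, hx.2.le.trans hτ.2⟩).hasDerivAt
      (Icc_mem_nhds hx.1 (hx.2.trans_le hτ.2)))
    ((hf'.mono hsub).intervalIntegrable_of_Icc hτ.1)
  rw [h0, sub_zero] at h
  rw [← h]
  refine (intervalIntegral.norm_integral_le_of_norm_le_const (C := M) fun x hx => ?_).trans
    (by rw [sub_zero, abs_of_nonneg hτ.1])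
  rw [uIoc_of_le hτ.1] at hx
  exact hM x ⟨hx.1.le, hx.2⟩

theorem exists_lipschitzOnWith_of_contDiffAt {F F' : Type*} [NormedAddCommGroup F]
    [NormedSpace ℝ F] [NormedAddCommGroup F'] [NormedSpace ℝ F'] {f : F → F'} {s : Set F}
    (hs : IsCompact s) (hf : ∀ x ∈ s, ContDiffAt ℝ 1 f x) : ∃ K, LipschitzOnWith K f s :=
  LocallyLipschitzOn.exists_lipschitzOnWith_of_compact hs fun x hx => by
    obtain ⟨K, t, ht, h⟩ := (hf x hx).exists_lipschitzOnWith
    exact ⟨K, t, mem_nhdsWithin_of_mem_nhds ht, h⟩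

/-- Uniqueness for a Fuchsian system. -/
theorem IsSol.unique {N : V → E →L[ℝ] E} {G : ℝ × V × E → E} {P : E →L[ℝ] V} {a₀ : V} {T : ℝ}
    {B : E →L[ℝ] E →L[ℝ] ℝ} {c : ℝ} (hB : IsEnergy (N a₀) B c) {S : Set V}
    (hN : ∀ a ∈ S, ContDiffAt ℝ 1 N a)
    (hG : ∀ τ, ∀ a ∈ S, ∀ y, ContDiffAt ℝ 1 G (τ, a, y)) {a₁ a₂ : ℝ → V} {y₁ y₂ : ℝ → E}
    (h₁ : IsSol N G P a₀ T a₁ y₁) (h₂ : IsSol N G P a₀ T a₂ y₂)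
    (hS₁ : ∀ τ ∈ Icc 0 T, a₁ τ ∈ S) (hS₂ : ∀ τ ∈ Icc 0 T, a₂ τ ∈ S) :
    ∀ τ ∈ Icc 0 T, a₁ τ = a₂ τ ∧ y₁ τ = y₂ τ := by
  rcases lt_or_ge T 0 with hT | hT
  · intro τ hτ; exact absurd (hτ.1.trans hτ.2) (not_le.2 hT)
  have h0T : (0 : ℝ) ∈ Icc 0 T := ⟨le_rfl, hT⟩
  set Q := a₁ '' Icc 0 T ∪ a₂ '' Icc 0 T with hQ
  have hQc : IsCompact Q :=
    (isCompact_Icc.image_of_continuousOn h₁.a_cont).union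
      (isCompact_Icc.image_of_continuousOn h₂.a_cont)
  have hQS : Q ⊆ S := by
    rintro _ (⟨τ, hτ, rfl⟩ | ⟨τ, hτ, rfl⟩)
    exacts [hS₁ τ hτ, hS₂ τ hτ]
  have hQ1 : ∀ τ ∈ Icc 0 T, a₁ τ ∈ Q := fun τ hτ => Or.inl (mem_image_of_mem _ hτ)
  have hQ2 : ∀ τ ∈ Icc 0 T, a₂ τ ∈ Q := fun τ hτ => Or.inr (mem_image_of_mem _ hτ)
  obtain ⟨K₁, hK₁⟩ := exists_lipschitzOnWith_of_contDiffAt hQc fun a ha => hN a (hQS ha)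
  obtain ⟨R₁, hR₁⟩ := isCompact_Icc.exists_bound_of_continuousOn h₁.y_cont
  obtain ⟨R₂, hR₂⟩ := isCompact_Icc.exists_bound_of_continuousOn h₂.y_cont
  set R := max R₁ R₂
  have hy₁ : ∀ τ ∈ Icc 0 T, ‖y₁ τ‖ ≤ R := fun τ hτ => (hR₁ τ hτ).trans (le_max_left _ _)
  have hy₂ : ∀ τ ∈ Icc 0 T, ‖y₂ τ‖ ≤ R := fun τ hτ => (hR₂ τ hτ).trans (le_max_right _ _)
  have hR0 : 0 ≤ R := (norm_nonneg _).trans (hy₁ 0 h0T)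
  obtain ⟨K₂, hK₂⟩ := exists_lipschitzOnWith_of_contDiffAt (f := G)
    (s := Icc (0 : ℝ) T ×ˢ Q ×ˢ Metric.closedBall (0 : E) R)
    (isCompact_Icc.prod (hQc.prod (isCompact_closedBall 0 R)))
    fun x hx => hG x.1 x.2.1 (hQS hx.2.1) x.2.2
  set δ : ℝ → E := fun τ => y₁ τ - y₂ τ with hδ
  have hδc : ContinuousOn δ (Icc 0 T) := h₁.y_cont.sub h₂.y_cont
  have hP := norm_nonneg P
  have hBn := norm_nonneg B
  have hc := hB.pos
  set C₁ : ℝ := 2 * (K₁ * ‖P‖ * R) + K₂ * (‖P‖ * T + 1) with hC₁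
  have hC₁0 : 0 ≤ C₁ := by positivity
  -- With this weight `‖B‖ C₁ / L < c`, which is what contradicts `D ≠ 0` at the end.
  set L : ℝ := 2 * (‖B‖ * C₁) / c + 1 with hL
  have hL0 : 0 < L := by positivity
  obtain ⟨τ₀, hτ₀, hmax⟩ := isCompact_Icc.exists_isMaxOn (f := fun τ => Real.exp (-(L * τ)) * ‖δ τ‖)
    ⟨0, h0T⟩ ((by fun_prop : Continuous fun τ => Real.exp (-(L * τ))).continuousOn.mul hδc.norm)
  set D := Real.exp (-(L * τ₀)) * ‖δ τ₀‖ with hD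
  have hD0 : 0 ≤ D := by positivity
  have hδle : ∀ τ ∈ Icc 0 T, ‖δ τ‖ ≤ D * Real.exp (L * τ) := fun τ hτ => by
    have : Real.exp (-(L * τ)) * ‖δ τ‖ ≤ D := hmax hτ
    have e : Real.exp (-(L * τ)) * Real.exp (L * τ) = 1 := by rw [← Real.exp_add]; simp
    calc ‖δ τ‖ = (Real.exp (-(L * τ)) * Real.exp (L * τ)) * ‖δ τ‖ := by rw [e, one_mul]
      _ = (Real.exp (-(L * τ)) * ‖δ τ‖) * Real.exp (L * τ) := by ring
      _ ≤ _ := mul_le_mul_of_nonneg_right this (Real.exp_pos _).le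
  have hα : ∀ τ ∈ Icc 0 T, ‖a₁ τ - a₂ τ‖ ≤ ‖P‖ * (D * Real.exp (L * τ)) * τ := fun τ hτ =>
    norm_le_of_hasDerivWithinAt (f := fun τ => a₁ τ - a₂ τ) (f' := fun τ => P (δ τ))
      (h₁.a_cont.sub h₂.a_cont) (by simp [h₁.a_zero, h₂.a_zero])
      (P.continuous.comp_continuousOn hδc)
      (fun s hs => ((h₁.a_deriv s hs).fun_sub (h₂.a_deriv s hs)).congr_deriv (by simp [hδ])) hτ
      fun s hs => P.le_opNorm_of_le ((hδle s ⟨hs.1, hs.2.trans hτ.2⟩).trans (by gcongr; exact hs.2))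
  have hα0 : ∀ τ ∈ Icc 0 T, ‖a₁ τ - a₀‖ ≤ ‖P‖ * R * τ := fun τ hτ =>
    norm_le_of_hasDerivWithinAt (f := fun τ => a₁ τ - a₀) (f' := fun τ => P (y₁ τ))
      (h₁.a_cont.sub continuousOn_const) (by simp [h₁.a_zero])
      (P.continuous.comp_continuousOn h₁.y_cont)
      (fun s hs => (h₁.a_deriv s hs).sub_const a₀) hτ
      fun s hs => P.le_opNorm_of_le (hy₁ s ⟨hs.1, hs.2.trans hτ.2⟩)
  -- Accretivity is known only for `N a₀`, so the singular coefficient is frozen there. What remains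
  -- is bounded, since `a₁ - a₀` and `a₁ - a₂` are `O(τ)`, the latter with a constant proportional
  -- to the weighted size of `δ`.
  set ρ : ℝ → E := fun τ => -(τ⁻¹ • ((N (a₁ τ) - N a₀) (δ τ) + (N (a₁ τ) - N (a₂ τ)) (y₂ τ)))
    + (G (τ, a₁ τ, y₁ τ) - G (τ, a₂ τ, y₂ τ)) with hρ
  have hδd : ∀ τ ∈ Ioc 0 T,
      HasDerivWithinAt δ (-(τ⁻¹ • N a₀ (δ τ)) + ρ τ) (Icc 0 T) τ := fun τ hτ => by
    refine ((h₁.y_deriv τ hτ).fun_sub (h₂.y_deriv τ hτ)).congr_deriv ?_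
    simp only [hρ, hδ, sub_apply, map_sub, smul_add, smul_sub]
    abel
  have hρle : ∀ τ ∈ Ioc 0 T, ‖ρ τ‖ ≤ C₁ * (D * Real.exp (L * τ)) := fun τ hτ => by
    have hτ' : τ ∈ Icc 0 T := ⟨hτ.1.le, hτ.2⟩
    have hτ0 := hτ.1.le
    set X := D * Real.exp (L * τ) with hX
    have hX0 : 0 ≤ X := by positivity
    have i1 : ‖(N (a₁ τ) - N a₀) (δ τ)‖ ≤ K₁ * (‖P‖ * R * τ) * X := by
      refine (ContinuousLinearMap.le_opNorm _ _).trans ?_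
      refine mul_le_mul ?_ (hδle τ hτ') (norm_nonneg _) (by positivity)
      have := hK₁.dist_le_mul _ (hQ1 τ hτ') _ (hQ1 0 h0T)
      rw [h₁.a_zero, dist_eq_norm, dist_eq_norm] at this
      exact this.trans (mul_le_mul_of_nonneg_left (hα0 τ hτ') K₁.2)
    have i2 : ‖(N (a₁ τ) - N (a₂ τ)) (y₂ τ)‖ ≤ K₁ * (‖P‖ * X * τ) * R := by
      refine (ContinuousLinearMap.le_opNorm _ _).trans ?_
      refine mul_le_mul ?_ (hy₂ τ hτ') (norm_nonneg _) (by positivity)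
      have := hK₁.dist_le_mul _ (hQ1 τ hτ') _ (hQ2 τ hτ')
      rw [dist_eq_norm, dist_eq_norm] at this
      exact this.trans (mul_le_mul_of_nonneg_left (hα τ hτ') K₁.2)
    have i3 : ‖G (τ, a₁ τ, y₁ τ) - G (τ, a₂ τ, y₂ τ)‖ ≤ K₂ * (‖P‖ * X * T + X) := by
      have := hK₂.dist_le_mul (τ, a₁ τ, y₁ τ) ⟨hτ', hQ1 τ hτ', by simpa using hy₁ τ hτ'⟩
        (τ, a₂ τ, y₂ τ) ⟨hτ', hQ2 τ hτ', by simpa using hy₂ τ hτ'⟩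
      rw [dist_eq_norm, dist_eq_norm] at this
      refine this.trans (mul_le_mul_of_nonneg_left ?_ K₂.2)
      have j1 := hα τ hτ'
      have j2 : ‖y₁ τ - y₂ τ‖ ≤ X := hδle τ hτ'
      have j3 : ‖P‖ * X * τ ≤ ‖P‖ * X * T := mul_le_mul_of_nonneg_left hτ.2 (by positivity)
      have j4 : 0 ≤ ‖P‖ * X * T := by positivity
      simp only [Prod.mk_sub_mk, Prod.norm_mk, sub_self, norm_zero, sup_le_iff]
      exact ⟨by positivity, by linarith, by linarith⟩
    refine (norm_add_le _ _).trans ?_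
    rw [norm_neg, norm_smul, Real.norm_of_nonneg (inv_nonneg.2 hτ0)]
    have i4 : τ⁻¹ * ‖(N (a₁ τ) - N a₀) (δ τ) + (N (a₁ τ) - N (a₂ τ)) (y₂ τ)‖
        ≤ 2 * (K₁ * ‖P‖ * R) * X := by
      have := (norm_add_le _ _).trans (add_le_add i1 i2)
      refine (mul_le_mul_of_nonneg_left this (inv_nonneg.2 hτ0)).trans (le_of_eq ?_)
      field_simp [hτ.1.ne']
      ring
    rw [hC₁]
    linarith
  -- The subtracted term has derivative `2 ‖B‖ C₁ (D e^{Lτ})²`, which dominates the derivative of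
  -- the energy once the accretive term is dropped.
  set H : ℝ → ℝ := fun τ => B (δ τ) (δ τ) - ‖B‖ * C₁ / L * D ^ 2 * Real.exp (2 * L * τ) with hH
  have hHc : ContinuousOn H (Icc 0 T) := by
    refine ContinuousOn.sub ((B.continuous.comp_continuousOn hδc).clm_apply hδc) ?_
    exact (by fun_prop : Continuous _).continuousOn
  have hanti : AntitoneOn H (Icc 0 T) := by
    refine antitoneOn_of_hasDerivWithinAt_nonpos (convex_Icc 0 T) hHc
      (f' := fun τ => 2 * B (-(τ⁻¹ • N a₀ (δ τ)) + ρ τ) (δ τ)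
        - ‖B‖ * C₁ / L * D ^ 2 * (Real.exp (2 * L * τ) * (2 * L))) ?_ ?_
    · intro τ hτ
      rw [interior_Icc] at hτ ⊢
      have hd : HasDerivAt δ _ τ :=
        (hδd τ ⟨hτ.1, hτ.2.le⟩).hasDerivAt (Icc_mem_nhds hτ.1 hτ.2)
      have h3 := ((B.hasFDerivAt (x := δ τ)).comp_hasDerivAt τ hd).clm_apply hd
      have h4 : HasDerivAt (fun τ => Real.exp (2 * L * τ)) (Real.exp (2 * L * τ) * (2 * L)) τ := by
        have := ((hasDerivAt_id τ).const_mul (2 * L)).exp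
        simpa using this
      refine ((h3.sub (h4.const_mul (‖B‖ * C₁ / L * D ^ 2))).congr_deriv ?_).hasDerivWithinAt
      simp only [Function.comp]
      rw [hB.symm (δ τ)]
      ring
    · intro τ hτ
      rw [interior_Icc] at hτ
      have hτ' : τ ∈ Icc 0 T := ⟨hτ.1.le, hτ.2.le⟩
      simp only [map_add, map_neg, map_smul, add_apply, neg_apply, smul_apply,
        smul_eq_mul]
      have i1 : 0 ≤ τ⁻¹ * B (N a₀ (δ τ)) (δ τ) :=
        mul_nonneg (inv_nonneg.2 hτ.1.le) (hB.accretive _)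
      have i2 : B (ρ τ) (δ τ) ≤ ‖B‖ * (C₁ * (D * Real.exp (L * τ))) * (D * Real.exp (L * τ)) := by
        refine ((le_abs_self _).trans (B.le_opNorm₂ _ _)).trans ?_
        have j1 := hρle τ ⟨hτ.1, hτ.2.le⟩
        have j2 := hδle τ hτ'
        gcongr
      have i3 : Real.exp (2 * L * τ) = Real.exp (L * τ) * Real.exp (L * τ) := by
        rw [← Real.exp_add]; ring_nf
      have i4 : ‖B‖ * C₁ / L * D ^ 2 * (Real.exp (2 * L * τ) * (2 * L))
          = 2 * (‖B‖ * (C₁ * (D * Real.exp (L * τ))) * (D * Real.exp (L * τ))) := by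
        rw [i3]; field_simp
      linarith
  have hH0 : H 0 ≤ 0 := by
    have : 0 ≤ ‖B‖ * C₁ / L * D ^ 2 := by positivity
    simp [hH, hδ, h₁.y_zero, h₂.y_zero, this]
  have hfin := (hanti h0T hτ₀ hτ₀.1).trans hH0
  have hco := hB.coercive (δ τ₀)
  have hδ₀ : ‖δ τ₀‖ = D * Real.exp (L * τ₀) := by
    rw [hD, mul_right_comm, ← Real.exp_add]; simp
  have hexp : Real.exp (2 * L * τ₀) = Real.exp (L * τ₀) ^ 2 := by
    rw [sq, ← Real.exp_add]; ring_nf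
  -- At the maximiser `τ₀` the bound on `δ` is an equality, so coercivity and `H τ₀ ≤ 0` give `c X²
  -- ≤ (‖B‖ C₁ / L) X²` with `X = D e^{L τ₀}`.
  have hDz : D = 0 := by
    have h5 : c * (D * Real.exp (L * τ₀)) ^ 2 ≤ ‖B‖ * C₁ / L * (D * Real.exp (L * τ₀)) ^ 2 := by
      rw [← hδ₀]
      simp only [hH, hexp] at hfin
      have : ‖B‖ * C₁ / L * D ^ 2 * Real.exp (L * τ₀) ^ 2 = ‖B‖ * C₁ / L * ‖δ τ₀‖ ^ 2 := by
        rw [hδ₀]; ring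
      linarith
    have h6 : ‖B‖ * C₁ / L < c := by
      rw [div_lt_iff₀ hL0, hL]
      have : c * (2 * (‖B‖ * C₁) / c + 1) = 2 * (‖B‖ * C₁) + c := by field_simp
      have h7 : 0 ≤ ‖B‖ * C₁ := by positivity
      rw [this]; linarith
    by_contra hne
    have h8 : 0 < (D * Real.exp (L * τ₀)) ^ 2 := by positivity
    exact absurd h5 (not_le.2 (mul_lt_mul_of_pos_right h6 h8))
  intro τ hτ
  have h9 := hα τ hτ
  have h10 := hδle τ hτ
  rw [hDz] at h9 h10
  simp only [zero_mul, mul_zero, norm_le_zero_iff] at h9 h10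
  exact ⟨sub_eq_zero.1 h9, sub_eq_zero.1 h10⟩

end Fuchsian

/-! ### Regularity up to the singular time. -/

namespace Fuchsian

open Filter Topology

section calculus

variable {F : Type*} [NormedAddCommGroup F] [NormedSpace ℝ F] {T : ℝ} {f f' : ℝ → F}

/-- A continuous function whose derivative has a limit at an endpoint is differentiable there, with
that limit as derivative. -/
theorem hasDerivWithinAt_Icc_of_Ioc (hT : 0 < T) (hf : ContinuousOn f (Icc 0 T))
    (hf' : ContinuousOn f' (Icc 0 T))
    (hd : ∀ τ ∈ Ioc 0 T, HasDerivWithinAt f (f' τ) (Icc 0 T) τ) :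
    ∀ τ ∈ Icc 0 T, HasDerivWithinAt f (f' τ) (Icc 0 T) τ := by
  intro τ hτ
  rcases hτ.1.eq_or_lt with h | h
  · subst h
    have hd' : ∀ x ∈ Ioo 0 T, HasDerivAt f (f' x) x := fun x hx =>
      (hd x ⟨hx.1, hx.2.le⟩).hasDerivAt (Icc_mem_nhds hx.1 hx.2)
    have hmem : Ioo 0 T ∈ 𝓝[>] (0 : ℝ) := Ioo_mem_nhdsGT hT
    refine (hasDerivWithinAt_Ici_of_tendsto_deriv (s := Ioo 0 T)
      (fun x hx => (hd' x hx).differentiableAt.differentiableWithinAt)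
      ((hf 0 hτ).mono Ioo_subset_Icc_self) hmem ?_).mono Icc_subset_Ici_self
    have h1 : Tendsto f' (𝓝[>] 0) (𝓝 (f' 0)) :=
      (hf' 0 hτ).mono_left (nhdsWithin_le_of_mem (mem_of_superset hmem Ioo_subset_Icc_self))
    refine h1.congr' ?_
    filter_upwards [hmem] with x hx
    exact (hd' x hx).deriv.symm
  · exact hd τ ⟨h, hτ.2⟩

theorem contDiffOn_of_hasDerivWithinAt (hT : 0 < T) (hf' : ContinuousOn f' (Icc 0 T))
    (hd : ∀ τ ∈ Icc 0 T, HasDerivWithinAt f (f' τ) (Icc 0 T) τ) :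
    ContDiffOn ℝ 1 f (Icc 0 T) := by
  have hu := uniqueDiffOn_Icc hT
  refine (contDiffOn_one_iff_derivWithin hu).2
    ⟨fun τ hτ => (hd τ hτ).differentiableWithinAt, hf'.congr fun τ hτ => ?_⟩
  exact (hd τ hτ).derivWithin (hu τ hτ)

end calculus

variable {E V : Type*} [NormedAddCommGroup E] [NormedSpace ℝ E]
  [NormedAddCommGroup V] [NormedSpace ℝ V]
  {N : V → E →L[ℝ] E} {G : ℝ × V × E → E} {P : E →L[ℝ] V} {a₀ : V} {T : ℝ} {a : ℝ → V} {y : ℝ → E}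

theorem IsSol.contDiffOn_a (h : IsSol N G P a₀ T a y) (hT : 0 < T) :
    ContDiffOn ℝ 1 a (Icc 0 T) :=
  have hc : ContinuousOn (fun τ => P (y τ)) (Icc 0 T) := P.continuous.comp_continuousOn h.y_cont
  contDiffOn_of_hasDerivWithinAt hT hc (hasDerivWithinAt_Icc_of_Ioc hT h.a_cont hc h.a_deriv)

theorem IsSol.contDiffOn_y (h : IsSol N G P a₀ T a y) (hT : 0 < T)
    (hN : ∀ τ ∈ Icc 0 T, ContinuousAt N (a τ))
    (hG : ∀ τ ∈ Icc 0 T, ContinuousAt G (τ, a τ, y τ)) {M : ℝ}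
    (hM : ∀ τ ∈ Icc 0 T, ‖y τ‖ ≤ M * τ ^ 2) : ContDiffOn ℝ 1 y (Icc 0 T) := by
  set g : ℝ → E := fun τ => -(τ⁻¹ • N (a τ) (y τ)) + G (τ, a τ, y τ) with hg
  have h0T : (0 : ℝ) ∈ Icc 0 T := ⟨le_rfl, hT.le⟩
  have hNc : ContinuousOn (fun τ => N (a τ)) (Icc 0 T) := fun τ hτ =>
    (hN τ hτ).comp_continuousWithinAt (h.a_cont τ hτ)
  have hGc : ContinuousOn (fun τ => G (τ, a τ, y τ)) (Icc 0 T) := fun τ hτ =>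
    ContinuousAt.comp_continuousWithinAt (f := fun τ => (τ, a τ, y τ)) (hG τ hτ)
      (continuousWithinAt_id.prodMk ((h.a_cont τ hτ).prodMk (h.y_cont τ hτ)))
  have hgc : ContinuousOn g (Icc 0 T) := by
    intro τ hτ
    refine ContinuousWithinAt.add (ContinuousWithinAt.neg ?_) (hGc τ hτ)
    rcases hτ.1.eq_or_lt with h0 | h0
    · subst h0
      -- By the convention `0⁻¹ = 0` the formula for `g` has singular term zero at `τ = 0`. This is
      -- the true limit, since `‖y‖ ≤ M τ²` leaves a factor `τ` after division.
      have hz : (0 : ℝ)⁻¹ • N (a 0) (y 0) = 0 := by simp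
      rw [ContinuousWithinAt, hz]
      have hlim : Tendsto (fun τ => ‖N (a τ)‖ * (|M| * |τ|)) (𝓝[Icc 0 T] 0) (𝓝 0) := by
        have h1 : ContinuousWithinAt (fun τ => ‖N (a τ)‖ * (|M| * |τ|)) (Icc 0 T) 0 :=
          (hNc 0 h0T).norm.mul (by fun_prop)
        simpa [ContinuousWithinAt] using h1
      refine squeeze_zero_norm' ?_ hlim
      filter_upwards [self_mem_nhdsWithin] with τ hτ
      rcases hτ.1.eq_or_lt with h1 | h1
      · subst h1; simp
      rw [norm_smul, norm_inv, Real.norm_eq_abs, abs_of_pos h1]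
      have h2 : ‖y τ‖ ≤ |M| * τ ^ 2 :=
        (hM τ hτ).trans (mul_le_mul_of_nonneg_right (le_abs_self M) (sq_nonneg τ))
      calc τ⁻¹ * ‖N (a τ) (y τ)‖ ≤ τ⁻¹ * (‖N (a τ)‖ * (|M| * τ ^ 2)) := by
            gcongr
            exact (N (a τ)).le_opNorm_of_le h2
        _ = ‖N (a τ)‖ * (|M| * τ) := by field_simp
    · exact (continuousAt_inv₀ h0.ne').continuousWithinAt.smul
        ((hNc τ hτ).clm_apply (h.y_cont τ hτ))
  exact contDiffOn_of_hasDerivWithinAt hT hgc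
    (hasDerivWithinAt_Icc_of_Ioc hT h.y_cont hgc h.y_deriv)

end Fuchsian

/-! ### The tensor operators in matrix form. -/

noncomputable section

namespace RescaledEV

open Matrix Topology

theorem quad_eq (b : Mat3) (p : Fin 3 → ℝ) : quad b p = p ⬝ᵥ b *ᵥ p := by
  simp only [quad, dotProduct, mulVec, Finset.mul_sum]
  exact Finset.sum_congr rfl fun i _ => Finset.sum_congr rfl fun j _ => by ring

theorem tr_eq (b : Mat3) {k : Mat3} (hk : k.IsSymm) : tr b k = (b * k).trace := by
  simp only [tr, Matrix.trace, diag, mul_apply]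
  exact Finset.sum_congr rfl fun i _ => Finset.sum_congr rfl fun j _ => by rw [hk.apply]

theorem contr_deltaT {k : Mat3} (hk : k.IsSymm) (i j : Fin 3) : contr deltaT k i j = k i j := by
  have := hk.apply i j
  simp only [contr, deltaT, kron, add_div, add_mul, Finset.sum_add_distrib]
  simp [div_mul_eq_mul_div, ← Finset.sum_div]
  rw [this]; ring

theorem contr_piT (a b k : Mat3) (i j : Fin 3) :
    contr (piT a b) k i j = 1 / 3 * (tr b k * a i j) := by
  simp only [contr, piT, tr, Finset.mul_sum, Finset.sum_mul]
  exact Finset.sum_congr rfl fun i _ => Finset.sum_congr rfl fun j _ => by ring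

/-- `Ψ_{ij}` as a matrix. -/
def PsiMat (a b : Mat3) (f : Mom → ℝ) : Mat3 := of fun i j => Psi a b f ![i, j]

/-- `χ_{ij}^{mn} k_{mn}` as a matrix. -/
def chiMat (a b : Mat3) (f : Mom → ℝ) (k : Mat3) : Mat3 := of (contr (chiT a b f) k)

theorem contr_PiT (a b k : Mat3) (f : Mom → ℝ) (i j : Fin 3) :
    contr (PiT a b f) k i j = tr b k * PsiMat a b f i j := by
  simp only [contr, PiT, PsiMat, tr, of_apply, Finset.sum_mul]
  exact Finset.sum_congr rfl fun i _ => Finset.sum_congr rfl fun j _ => by ring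

/-- The magnetic bracket contracted with a symmetric `k`. -/
def magMat (a b : Mat3) (h : Fin 3 → ℝ) (k : Mat3) : Mat3 :=
  quad k h • a + quad a h • k
    - (2 : ℝ) • (vecMulVec (a *ᵥ h) (k *ᵥ h) + vecMulVec (k *ᵥ h) (a *ᵥ h))
    + tr b k • ((2 : ℝ) • vecMulVec (a *ᵥ h) (a *ᵥ h) - quad a h • a)

theorem contr_magBracket (a b : Mat3) (h : Fin 3 → ℝ) {k : Mat3} (hk : k.IsSymm) (i j : Fin 3) :
    contr (magBracket a b h) k i j = magMat a b h k i j := by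
  have e : contr (magBracket a b h) k i j
      = quad k h * a i j + quad a h * contr deltaT k i j
        - 2 * ((a *ᵥ h) i * (∑ m, kron m j * (k *ᵥ h) m)
          + (∑ m, kron m i * (k *ᵥ h) m) * (a *ᵥ h) j)
        + tr b k * (2 * ((a *ᵥ h) i * (a *ᵥ h) j) - quad a h * a i j) := by
    simp only [contr, magBracket, quad, tr, mulVec, dotProduct, Fin.sum_univ_three]
    ring
  have e2 : ∀ l, ∑ m, kron m l * (k *ᵥ h) m = (k *ᵥ h) l := fun l => by simp [kron]
  rw [e, e2, e2, contr_deltaT hk]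
  simp only [magMat, Matrix.add_apply, Matrix.sub_apply, Matrix.smul_apply, vecMulVec_apply,
    smul_eq_mul]

theorem sum_magUp (a b : Mat3) (h : Fin 3 → ℝ) {k : Mat3} (hk : k.IsSymm) (p q : Fin 3) :
    contr (magUp a b h) k p q = (2 / a.det) * (quad k h • b
      + quad a h • (b * k * bᵀ)
      - (2 : ℝ) • (vecMulVec h (b *ᵥ k *ᵥ h) + vecMulVec (b *ᵥ k *ᵥ h) h)
      + tr b k • ((2 : ℝ) • vecMulVec h h - quad a h • b)) p q := by
  have h10 := hk.apply 0 1
  have h20 := hk.apply 0 2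
  have h21 := hk.apply 1 2
  simp only [Matrix.add_apply, Matrix.sub_apply, Matrix.smul_apply, vecMulVec_apply,
    smul_eq_mul, mul_apply, transpose_apply, mulVec, dotProduct, contr, magUp, tr,
    Fin.sum_univ_three]
  generalize quad a h = Q
  simp only [quad, Fin.sum_univ_three, h10, h20, h21]
  ring

/-- Lowering two indices with `a` turns `b` into `a`, `b k b` into `k` and `h` into `a h`. The
magnetic tensor of the compatibility condition is thereby the one in the evolution equation, so both
involve the same operator `Lmat`. -/
theorem contr_magT {a b : Mat3} (h : Fin 3 → ℝ) {k : Mat3} (ha : a.IsSymm) (hb : b.IsSymm)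
    (hab : a * b = 1) (hk : k.IsSymm) (i j : Fin 3) :
    contr (magT a b h) k i j = 2 / a.det * magMat a b h k i j := by
  have hba : b * a = 1 := mul_eq_one_comm.1 hab
  have e : contr (magT a b h) k i j = (a * of (contr (magUp a b h) k) * aᵀ) i j := by
    simp only [contr, magT, mul_apply, transpose_apply, of_apply,
      Fin.sum_univ_three]
    ring
  have e2 : of (contr (magUp a b h) k) = (2 / a.det) • (quad k h • b
      + quad a h • (b * k * bᵀ)
      - (2 : ℝ) • (vecMulVec h (b *ᵥ k *ᵥ h) + vecMulVec (b *ᵥ k *ᵥ h) h)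
      + tr b k • ((2 : ℝ) • vecMulVec h h - quad a h • b)) := by
    ext p q
    exact sum_magUp a b h hk p q
  have v1 : ∀ x, x ᵥ* a = a *ᵥ x := fun x => by
    have := vecMul_transpose a x
    rwa [ha.eq] at this
  have v2 : ∀ x, a *ᵥ b *ᵥ x = x := fun x => by rw [mulVec_mulVec, hab, one_mulVec]
  have m1 : a * (b * k * b) * a = k := by
    calc a * (b * k * b) * a = (a * b) * k * (b * a) := by noncomm_ring
      _ = k := by rw [hab, hba, one_mul, mul_one]
  have m2 : a * b * a = a := by rw [hab, one_mul]
  rw [e, e2, ha.eq, hb.eq]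
  simp only [mul_smul_comm, smul_mul_assoc, mul_add, add_mul, mul_sub, sub_mul, mul_vecMulVec,
    vecMulVec_mul, v1, v2, m1, m2, magMat]
  simp only [Matrix.smul_apply, smul_eq_mul]

/-- The operator `1 - χ + Π - 𝓜` on symmetric matrices. -/
def Lmat (a b : Mat3) (f : Mom → ℝ) (h : Fin 3 → ℝ) (k : Mat3) : Mat3 :=
  k - chiMat a b f k + tr b k • PsiMat a b f - (2 / a.det) • magMat a b h k

theorem trace_mul_vecMulVec (w : Mat3) (x y : Fin 3 → ℝ) :
    (w * vecMulVec x y).trace = y ⬝ᵥ w *ᵥ x := by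
  rw [mul_vecMulVec, trace_vecMulVec, dotProduct_comm]

theorem dotProduct_mulVec_symm {w : Mat3} (hw : w.IsSymm) (x y : Fin 3 → ℝ) :
    x ⬝ᵥ w *ᵥ y = y ⬝ᵥ w *ᵥ x := by
  rw [dotProduct_mulVec, dotProduct_comm]
  congr 1
  have := vecMul_transpose w x
  rwa [hw.eq] at this

/-- The metric Fuchsian condition. -/
def MetricCond (a b : Mat3) (f : Mom → ℝ) (h : Fin 3 → ℝ) : Prop :=
  (2 : ℝ) • PsiMat a b f
    = a - (2 / a.det) • (quad a h • a - (2 : ℝ) • vecMulVec (a *ᵥ h) (a *ᵥ h))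

theorem InitialData.Fuchsian.metricCond {D : InitialData} (hF : D.Fuchsian) :
    MetricCond D.a D.b D.f D.h := by
  ext i j
  have := hF.metric i j
  simp only [Matrix.sub_apply, Matrix.smul_apply, smul_eq_mul, vecMulVec_apply, PsiMat, of_apply,
    this, quad, mulVec, dotProduct, Fin.sum_univ_three]
  ring

theorem MetricCond.trace_mul {a b : Mat3} {f : Mom → ℝ} {h : Fin 3 → ℝ} (hm : MetricCond a b f h)
    (w : Mat3) : (w * PsiMat a b f).trace = 1 / 2 * ((1 - 2 * (quad a h / a.det)) * (w * a).trace
      + 4 / a.det * ((a *ᵥ h) ⬝ᵥ w *ᵥ (a *ᵥ h))) := by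
  have h1 := congrArg (fun M => (w * M).trace) hm
  simp only [mul_smul_comm, mul_sub, trace_smul, trace_sub, trace_mul_vecMulVec, smul_eq_mul] at h1
  linear_combination h1 / 2

/-! ### Moment integrals of the distribution function. -/

theorem quad_pos {b : Mat3} (hb : b.PosDef) {p : Fin 3 → ℝ} (hp : p ≠ 0) : 0 < quad b p := by
  rw [quad_eq]
  simpa using hb.dotProduct_mulVec_pos hp

theorem quad_nonneg {b : Mat3} (hb : b.PosDef) (p : Fin 3 → ℝ) : 0 ≤ quad b p := by
  rw [quad_eq]
  simpa using hb.posSemidef.dotProduct_mulVec_nonneg p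

theorem continuous_quad (b : Mat3) : Continuous (quad b) := by
  unfold quad; fun_prop

/-- The distribution functions that are allowed as data. -/
structure IsDatum (f : Mom → ℝ) : Prop where
  smooth : ContDiff ℝ ∞ f
  compact : HasCompactSupport f
  support : (0 : Mom) ∉ tsupport f
  nonneg : ∀ p, 0 ≤ f p

theorem InitialData.isDatum (D : InitialData) : IsDatum D.f :=
  ⟨D.f_smooth, D.f_compact, D.f_support, D.f_nonneg⟩

namespace IsDatum

variable {f : Mom → ℝ} (hf : IsDatum f)
include hf

theorem eq_zero : f 0 = 0 := image_eq_zero_of_notMem_tsupport hf.support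

/-- The power of `quad b p` may be singular only at `p = 0`, and `f` vanishes in a neighbourhood of
that point. -/
theorem continuous_mul {b : Mat3} (hb : b.PosDef) (s : ℝ) {g : Mom → ℝ} (hg : Continuous g) :
    Continuous fun p => quad b p ^ s * g p * f p := by
  rw [continuous_iff_continuousAt]
  intro p
  by_cases hp : p = 0
  · subst hp
    have h0 : f =ᶠ[𝓝 0] 0 := notMem_tsupport_iff_eventuallyEq.1 hf.support
    refine (continuousAt_const (y := (0 : ℝ))).congr ?_
    filter_upwards [h0] with p hp
    simp [hp]
  · exact (((continuous_quad b).continuousAt.rpow_const (Or.inl (quad_pos hb hp).ne')).mul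
      hg.continuousAt).mul hf.smooth.continuous.continuousAt

theorem integrable_mul {b : Mat3} (hb : b.PosDef) (s : ℝ) {g : Mom → ℝ} (hg : Continuous g) :
    Integrable fun p => quad b p ^ s * g p * f p :=
  (hf.continuous_mul hb s hg).integrable_of_hasCompactSupport hf.compact.mul_left

theorem sum_mul_Psi {a b : Mat3} (hb : b.PosDef) {n : ℕ} {ι : Type*} [Fintype ι] (c : ι → ℝ)
    (I : ι → Fin n → Fin 3) : ∑ x, c x * Psi a b f (I x) = 4 * Real.pi / Real.sqrt a.det *
      ∫ p : Mom, quad b p ^ (-((n : ℝ) - 1) / 2) * (∑ x, c x * ∏ s, p (I x s)) * f p := by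
  have h1 : ∀ p : Mom, quad b p ^ (-((n : ℝ) - 1) / 2) * (∑ x, c x * ∏ s, p (I x s)) * f p
      = ∑ x, c x * (quad b p ^ (-((n : ℝ) - 1) / 2) * (∏ s, p (I x s)) * f p) := fun p => by
    rw [Finset.mul_sum, Finset.sum_mul]
    exact Finset.sum_congr rfl fun x _ => by ring
  simp_rw [h1]
  rw [integral_finsetSum _ fun x _ =>
    (hf.integrable_mul hb _ (by fun_prop : Continuous fun p : Mom => ∏ s, p (I x s))).const_mul _,
    Finset.mul_sum]
  refine Finset.sum_congr rfl fun x _ => ?_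
  rw [integral_const_mul, Psi]
  ring

theorem trace_mul_PsiMat {a b : Mat3} (hb : b.PosDef) (w : Mat3) :
    (w * PsiMat a b f).trace = 4 * Real.pi / Real.sqrt a.det *
      ∫ p : Mom, quad b p ^ (-(((2 : ℕ) : ℝ) - 1) / 2) * quad w p * f p := by
  have h := hf.sum_mul_Psi (a := a) hb (fun x : Fin 3 × Fin 3 => w x.1 x.2) fun x => ![x.2, x.1]
  have e1 : (w * PsiMat a b f).trace = ∑ x : Fin 3 × Fin 3, w x.1 x.2 * Psi a b f ![x.2, x.1] := by
    rw [Fintype.sum_prod_type]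
    simp only [Matrix.trace, diag, mul_apply, PsiMat, of_apply]
  have e2 : ∀ p : Mom, ∑ x : Fin 3 × Fin 3, w x.1 x.2 * ∏ s, p (![x.2, x.1] s) = quad w p := by
    intro p
    rw [Fintype.sum_prod_type]
    simp only [quad, Fin.prod_univ_two, cons_val_zero, cons_val_one]
    exact Finset.sum_congr rfl fun x _ => Finset.sum_congr rfl fun x _ => by ring
  rw [e1, h]
  simp_rw [e2]

omit hf in
theorem contr_chiT (a b k : Mat3) (i j : Fin 3) :
    contr (chiT a b f) k i j = ∑ m, ∑ n, (b * k * bᵀ) m n * Psi a b f ![i, j, m, n] := by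
  simp only [contr, chiT]
  generalize (fun m n => Psi a b f ![i, j, m, n]) = F
  simp only [mul_apply, transpose_apply, Fin.sum_univ_three]
  ring

theorem trace_mul_chiMat {a b : Mat3} (hb : b.PosDef) (w k : Mat3) :
    (w * chiMat a b f k).trace = 4 * Real.pi / Real.sqrt a.det *
      ∫ p : Mom, quad b p ^ (-(((4 : ℕ) : ℝ) - 1) / 2) * (quad w p * quad (b * k * bᵀ) p)
        * f p := by
  have h := hf.sum_mul_Psi (a := a) hb
    (fun x : Fin 3 × Fin 3 × Fin 3 × Fin 3 => w x.1 x.2.1 * (b * k * bᵀ) x.2.2.1 x.2.2.2)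
    fun x => ![x.2.1, x.1, x.2.2.1, x.2.2.2]
  have e1 : (w * chiMat a b f k).trace = ∑ x : Fin 3 × Fin 3 × Fin 3 × Fin 3,
      w x.1 x.2.1 * (b * k * bᵀ) x.2.2.1 x.2.2.2
        * Psi a b f ![x.2.1, x.1, x.2.2.1, x.2.2.2] := by
    have e0 : chiMat a b f k
        = of fun i j => ∑ m, ∑ n, (b * k * bᵀ) m n * Psi a b f ![i, j, m, n] := by
      ext i j; exact contr_chiT a b k i j
    rw [e0]
    generalize b * k * bᵀ = u
    simp only [Fintype.sum_prod_type, Matrix.trace, diag, Matrix.mul_apply, of_apply,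
      Finset.mul_sum, mul_assoc]
  have e2 : ∀ p : Mom, ∑ x : Fin 3 × Fin 3 × Fin 3 × Fin 3,
      w x.1 x.2.1 * (b * k * bᵀ) x.2.2.1 x.2.2.2 * ∏ s, p (![x.2.1, x.1, x.2.2.1, x.2.2.2] s)
      = quad w p * quad (b * k * bᵀ) p := by
    intro p
    simp only [Fintype.sum_prod_type]
    generalize b * k * bᵀ = u
    simp only [quad, Fin.prod_univ_four, cons_val, Finset.sum_mul]
    simp only [Finset.mul_sum]
    exact Finset.sum_congr rfl fun _ _ => Finset.sum_congr rfl fun _ _ =>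
      Finset.sum_congr rfl fun _ _ => Finset.sum_congr rfl fun _ _ => by ring
  rw [e1, h]
  simp_rw [e2]

omit hf in
theorem prefactor_nonneg (a : Mat3) : 0 ≤ 4 * Real.pi / Real.sqrt a.det := by positivity

theorem trace_mul_PsiMat_nonneg {a b : Mat3} (hb : b.PosDef) {w : Mat3} (hw : ∀ p, 0 ≤ quad w p) :
    0 ≤ (w * PsiMat a b f).trace := by
  rw [hf.trace_mul_PsiMat hb]
  refine mul_nonneg (prefactor_nonneg a) (integral_nonneg fun p => ?_)
  exact mul_nonneg (mul_nonneg (Real.rpow_nonneg (quad_nonneg hb p) _) (hw p)) (hf.nonneg p)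

omit hf in
theorem rpow_quad_mul {b : Mat3} (hb : b.PosDef) {p : Mom} (hp : p ≠ 0) :
    quad b p ^ (-(((2 : ℕ) : ℝ) - 1) / 2)
      = quad b p ^ (-(((4 : ℕ) : ℝ) - 1) / 2) * quad b p := by
  rw [← Real.rpow_add_one (quad_pos hb hp).ne']
  norm_num

/-- Contracting `χ` with `b` inserts a factor `quad b p`, which raises the exponent `-3/2` of the
fourth moment to the `-1/2` of the second. -/
theorem trace_mul_chiMat_self {a b : Mat3} (hb : b.PosDef) (k : Mat3) :
    (b * chiMat a b f k).trace = ((b * k * bᵀ) * PsiMat a b f).trace := by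
  rw [hf.trace_mul_PsiMat hb, hf.trace_mul_chiMat hb]
  congr 1
  refine integral_congr_ae (Filter.Eventually.of_forall fun p => ?_)
  by_cases hp : p = 0
  · simp [hp, hf.eq_zero]
  · simp only [rpow_quad_mul hb hp]; ring

/-- Pointwise comparison under the integral: `hw` will be Cauchy-Schwarz for `b`, and the spare
factor `quad b p` turns a fourth moment into a second one, which the metric condition evaluates. -/
theorem trace_mul_chiMat_le {a b : Mat3} (hb : b.PosDef) {w : Mat3} (k : Mat3)
    (hw : ∀ p, quad (b * k * bᵀ) p ^ 2 ≤ quad b p * quad w p) :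
    ((b * k * bᵀ) * chiMat a b f k).trace ≤ (w * PsiMat a b f).trace := by
  rw [hf.trace_mul_PsiMat hb, hf.trace_mul_chiMat hb]
  refine mul_le_mul_of_nonneg_left (integral_mono
    (hf.integrable_mul hb _ ((continuous_quad _).mul (continuous_quad _)))
    (hf.integrable_mul hb _ (continuous_quad _)) fun p => ?_) (prefactor_nonneg a)
  by_cases hp : p = 0
  · simp [hp, hf.eq_zero]
  · simp only [rpow_quad_mul hb hp]
    have h1 := mul_le_mul_of_nonneg_left (hw p) (mul_nonneg
      (Real.rpow_nonneg (quad_nonneg hb p) (-(((4 : ℕ) : ℝ) - 1) / 2)) (hf.nonneg p))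
    linarith

theorem trace_mul_chiMat_comm {a b : Mat3} (hb : b.PosDef) (v k : Mat3) :
    ((b * v * bᵀ) * chiMat a b f k).trace = ((b * k * bᵀ) * chiMat a b f v).trace := by
  rw [hf.trace_mul_chiMat hb, hf.trace_mul_chiMat hb]
  simp_rw [mul_comm (quad (b * v * bᵀ) _)]

omit hf in
theorem isSymm_PsiMat (a b : Mat3) : (PsiMat a b f).IsSymm := by
  ext i j
  simp only [PsiMat, transpose_apply, of_apply, Psi, Fin.prod_univ_two, cons_val]
  simp_rw [mul_comm (_ : ℝ) (_ : ℝ)]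

omit hf in
theorem isSymm_chiMat (a b k : Mat3) : (chiMat a b f k).IsSymm := by
  ext i j
  simp only [chiMat, transpose_apply, of_apply, contr_chiT, Psi, Fin.prod_univ_four, cons_val]
  refine Finset.sum_congr rfl fun m _ => Finset.sum_congr rfl fun n _ => ?_
  congr 2
  refine integral_congr_ae (Filter.Eventually.of_forall fun p => ?_)
  ring

end IsDatum

/-! ### The energy inequality. -/

theorem isSymm_of_posDef {a : Mat3} (ha : a.PosDef) : a.IsSymm := ha.isHermitian

theorem sq_dotProduct_mulVec_le {M : Mat3} (hM : M.PosDef) (x y : Fin 3 → ℝ) :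
    (x ⬝ᵥ M *ᵥ y) ^ 2 ≤ (x ⬝ᵥ M *ᵥ x) * (y ⬝ᵥ M *ᵥ y) := by
  have h := LinearMap.BilinForm.apply_mul_apply_le_of_forall_zero_le (Matrix.toBilin' M)
    (fun z => by
      rw [toBilin'_apply', ← quad_eq]
      exact quad_nonneg hM z) x y
  simp only [toBilin'_apply'] at h
  rw [dotProduct_mulVec_symm (isSymm_of_posDef hM) y x] at h
  rwa [sq]

/-- Writing `b = ∑ vᵢ vᵢᵀ`, the trace is `∑ quad b (k vᵢ)`. If it vanishes, then every `k vᵢ = 0`,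
so `k b = 0` and `k = 0`. -/
theorem trace_sq_nonneg {b k : Mat3} (hb : b.PosDef) (hk : k.IsSymm) :
    0 ≤ (b * k * b * k).trace ∧ ((b * k * b * k).trace = 0 → k = 0) := by
  obtain ⟨m, v, hv⟩ := Matrix.posSemidef_iff_eq_sum_vecMulVec.1 hb.posSemidef
  have e : (b * k * b * k).trace = ∑ i, quad b (k *ᵥ v i) := by
    have : (b * k * b * k).trace = ((k * b * k) * b).trace := by
      rw [Matrix.trace_mul_comm (k * b * k) b]; simp only [mul_assoc]
    rw [this]
    nth_rewrite 2 [hv]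
    rw [Matrix.mul_sum, trace_sum]
    refine Finset.sum_congr rfl fun i _ => ?_
    rw [trace_mul_vecMulVec, quad_eq, star_trivial, ← mulVec_mulVec, ← mulVec_mulVec,
      dotProduct_mulVec_symm hk, dotProduct_comm, dotProduct_mulVec_symm (isSymm_of_posDef hb),
      dotProduct_comm, dotProduct_comm]
  have h0 : ∀ i ∈ Finset.univ, 0 ≤ quad b (k *ᵥ v i) := fun i _ => quad_nonneg hb _
  rw [e]
  refine ⟨Finset.sum_nonneg h0, fun h => ?_⟩
  have h1 := (Finset.sum_eq_zero_iff_of_nonneg h0).1 h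
  have h2 : ∀ i, k *ᵥ v i = 0 := fun i => by
    by_contra hne
    exact (quad_pos hb hne).ne' (h1 i (Finset.mem_univ i))
  have h3 : k * b = 0 := by
    rw [hv, Matrix.mul_sum]
    exact Finset.sum_eq_zero fun i _ => by rw [mul_vecMulVec, h2, zero_vecMulVec]
  have h4 : b * b⁻¹ = 1 := mul_nonsing_inv b hb.det_pos.ne'.isUnit
  rw [← mul_one k, ← h4, ← mul_assoc, h3, zero_mul]

section energy

variable {a b : Mat3} {h : Fin 3 → ℝ} {f : Mom → ℝ}

theorem mulVec_inv (hab : a * b = 1) (x : Fin 3 → ℝ) : b *ᵥ a *ᵥ x = x := by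
  rw [mulVec_mulVec, mul_eq_one_comm.1 hab, one_mulVec]

theorem sandwich_mulVec (hb : b.PosDef) (hab : a * b = 1) (v : Mat3) (x y : Fin 3 → ℝ) :
    (a *ᵥ y) ⬝ᵥ (b * v * b) *ᵥ (a *ᵥ x) = y ⬝ᵥ v *ᵥ x := by
  rw [← mulVec_mulVec, ← mulVec_mulVec, mulVec_inv hab,
    dotProduct_mulVec_symm (isSymm_of_posDef hb), mulVec_inv hab, dotProduct_comm]

theorem trace_sandwich (hab : a * b = 1) (v : Mat3) : (b * v * b * a).trace = (b * v).trace := by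
  rw [mul_assoc, mul_eq_one_comm.1 hab, mul_one]

theorem trace_mul_magMat (hb : b.PosDef) (hab : a * b = 1) {v k : Mat3}
    (hv : v.IsSymm) (hk : k.IsSymm) :
    (b * v * b * magMat a b h k).trace = quad k h * (b * v).trace
      + quad a h * (b * v * b * k).trace - 4 * ((k *ᵥ h) ⬝ᵥ b *ᵥ (v *ᵥ h))
      + (b * k).trace * (2 * quad v h - quad a h * (b * v).trace) := by
  have hbs := isSymm_of_posDef hb
  have h1 : (k *ᵥ h) ⬝ᵥ (b * v * b) *ᵥ (a *ᵥ h) = (k *ᵥ h) ⬝ᵥ b *ᵥ (v *ᵥ h) := by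
    rw [← mulVec_mulVec, ← mulVec_mulVec, mulVec_inv hab]
  have hs : (b * v * b).IsSymm := by
    rw [IsSymm, transpose_mul, transpose_mul, hbs.eq, hv.eq, mul_assoc]
  have h2 : (a *ᵥ h) ⬝ᵥ (b * v * b) *ᵥ (k *ᵥ h) = (k *ᵥ h) ⬝ᵥ b *ᵥ (v *ᵥ h) := by
    rw [dotProduct_mulVec_symm hs, h1]
  simp only [magMat, mul_add, mul_sub, mul_smul_comm, trace_add, trace_sub, trace_smul,
    trace_mul_vecMulVec, h1, h2, sandwich_mulVec hb hab, trace_sandwich hab, ← quad_eq, smul_eq_mul,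
    tr_eq b hk]
  ring

theorem trace_mul_PsiMat_sandwich (hb : b.PosDef) (hab : a * b = 1)
    (hm : MetricCond a b f h) (v : Mat3) :
    (b * v * b * PsiMat a b f).trace = 1 / 2 * ((1 - 2 * (quad a h / a.det)) * (b * v).trace
      + 4 / a.det * quad v h) := by
  rw [hm.trace_mul, sandwich_mulVec hb hab, trace_sandwich hab, ← quad_eq]

theorem trace_mul_Lmat (hb : b.PosDef) (hab : a * b = 1) (hm : MetricCond a b f h) {v k : Mat3}
    (hv : v.IsSymm) (hk : k.IsSymm) :
    (b * v * b * Lmat a b f h k).trace = (b * v * b * k).trace - (b * v * b * chiMat a b f k).trace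
      + (b * k).trace * (1 / 2 * ((1 - 2 * (quad a h / a.det)) * (b * v).trace
        + 4 / a.det * quad v h))
      - 2 / a.det * (quad k h * (b * v).trace
      + quad a h * (b * v * b * k).trace - 4 * ((k *ᵥ h) ⬝ᵥ b *ᵥ (v *ᵥ h))
      + (b * k).trace * (2 * quad v h - quad a h * (b * v).trace)) := by
  rw [Lmat]
  simp only [mul_add, mul_sub, mul_smul_comm, trace_add, trace_sub, trace_smul, smul_eq_mul,
    trace_mul_magMat hb hab hv hk, trace_mul_PsiMat_sandwich hb hab hm, tr_eq b hk]

/-- The contributions of `Π` and `𝓜` are not symmetric separately. Once `Ψ` is replaced through the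
metric condition, the terms `tr(bk) quad v h` and `quad k h tr(bv)` occur with equal coefficients.
-/
theorem trace_mul_Lmat_comm (hf : IsDatum f) (hb : b.PosDef) (hab : a * b = 1)
    (hm : MetricCond a b f h) {v k : Mat3} (hv : v.IsSymm) (hk : k.IsSymm) :
    (b * v * b * Lmat a b f h k).trace = (b * k * b * Lmat a b f h v).trace := by
  have h1 := hf.trace_mul_chiMat_comm (a := a) hb v k
  rw [(isSymm_of_posDef hb).eq] at h1
  have h2 : (b * v * b * k).trace = (b * k * b * v).trace := by
    rw [mul_assoc (b * v), Matrix.trace_mul_comm, ← mul_assoc]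
  have h3 : (k *ᵥ h) ⬝ᵥ b *ᵥ (v *ᵥ h) = (v *ᵥ h) ⬝ᵥ b *ᵥ (k *ᵥ h) :=
    dotProduct_mulVec_symm (isSymm_of_posDef hb) _ _
  rw [trace_mul_Lmat hb hab hm hv hk, trace_mul_Lmat hb hab hm hk hv, h1, h2, h3]
  ring

/-- This is the pairing of `L k` with `v = a`, for which `b v b = b`. The terms containing `h`
cancel by the metric condition. -/
theorem trace_Lmat (hf : IsDatum f) (ha : a.PosDef) (hb : b.PosDef) (hab : a * b = 1)
    (hm : MetricCond a b f h) {k : Mat3} (hk : k.IsSymm) :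
    (b * Lmat a b f h k).trace = 2 * (b * k).trace := by
  have hba := mul_eq_one_comm.1 hab
  have h0 : b * a * b = b := by rw [hba, one_mul]
  have h1 := trace_mul_Lmat hb hab hm (isSymm_of_posDef ha) hk
  have h2 := hf.trace_mul_chiMat_self (a := a) hb k
  rw [(isSymm_of_posDef hb).eq, trace_mul_PsiMat_sandwich hb hab hm] at h2
  have h3 : (k *ᵥ h) ⬝ᵥ b *ᵥ (a *ᵥ h) = quad k h := by
    rw [mulVec_inv hab, dotProduct_comm, quad_eq]
  rw [h0, h2, h3, hba, trace_one] at h1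
  rw [h1]
  simp only [Fintype.card_fin]
  push_cast
  ring

/-- The form `|h|² b - h ⊗ h` is nonnegative by Cauchy-Schwarz and annihilates `a h`. Its pairing
with `Ψ` is nonnegative because `f` is, and the metric condition evaluates it as `|h|² (1 - 2 |h|² /
det a)`. -/
theorem quad_div_det_le (hf : IsDatum f) (ha : a.PosDef) (hb : b.PosDef) (hab : a * b = 1)
    (hm : MetricCond a b f h) : quad a h / a.det ≤ 1 / 2 := by
  by_cases hh : h = 0
  · subst hh; simp [quad]
  have hq := quad_pos ha hh
  have h1 := hf.trace_mul_PsiMat_nonneg (a := a) hb (w := quad a h • b - vecMulVec h h) (fun p => by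
    have h2 := sq_dotProduct_mulVec_le hb p (a *ᵥ h)
    rw [mulVec_inv hab, dotProduct_comm (a *ᵥ h), ← quad_eq, ← quad_eq] at h2
    have h3 : quad (quad a h • b - vecMulVec h h) p = quad b p * quad a h - (p ⬝ᵥ h) ^ 2 := by
      rw [quad_eq, sub_mulVec, dotProduct_sub, smul_mulVec, dotProduct_smul, ← quad_eq,
        vecMulVec_mulVec, dotProduct_comm h p]
      simp only [smul_eq_mul, dotProduct_smul, op_smul_eq_smul]
      ring
    rw [h3]; linarith)
  rw [hm.trace_mul] at h1
  have h2 : ((quad a h • b - vecMulVec h h) * a).trace = 2 * quad a h := by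
    rw [sub_mul, trace_sub, smul_mul_assoc, trace_smul, mul_eq_one_comm.1 hab, trace_one,
      Matrix.trace_mul_comm, trace_mul_vecMulVec, ← quad_eq]
    simp only [Fintype.card_fin, smul_eq_mul]
    push_cast
    ring
  have h3 : (a *ᵥ h) ⬝ᵥ (quad a h • b - vecMulVec h h) *ᵥ (a *ᵥ h) = 0 := by
    rw [sub_mulVec, dotProduct_sub, smul_mulVec, dotProduct_smul, mulVec_inv hab,
      vecMulVec_mulVec, dotProduct_comm _ h, ← quad_eq]
    simp only [smul_eq_mul, dotProduct_smul, op_smul_eq_smul]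
    rw [dotProduct_comm _ h, ← quad_eq]; ring
  rw [h2, h3] at h1
  by_contra hlt
  push Not at hlt
  nlinarith

/-- Put `s = tr(bkbk)`, `κ = tr(bk)`, `t = 1 / det a`, `q = t |h|²`, `y = t quad k h` and `θ = quad
b (k h)`. Bounding the `χ` term by Cauchy-Schwarz in `p` and then by the metric condition leaves at
least `(1/2 - q) s + κ²/2 + q κ² - 4 κ y + 6 t θ`. A second Cauchy-Schwarz with `q ≤ 1/2` gives `y²
≤ t θ / 2`. -/
theorem trace_mul_Lmat_nonneg (hf : IsDatum f) (ha : a.PosDef) (hb : b.PosDef) (hab : a * b = 1)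
    (hm : MetricCond a b f h) {k : Mat3} (hk : k.IsSymm) :
    0 ≤ (b * k * b * Lmat a b f h k).trace := by
  have hbs := isSymm_of_posDef hb
  have hH := quad_div_det_le hf ha hb hab hm
  have hs := (trace_sq_nonneg hb hk).1
  have hdet := ha.det_pos
  have hX : (b * k * b * chiMat a b f k).trace ≤ (b * (k * b * k) * b * PsiMat a b f).trace := by
    have := hf.trace_mul_chiMat_le (a := a) hb (w := b * (k * b * k) * b) k fun p => by
      have h2 := sq_dotProduct_mulVec_le hb p (k *ᵥ b *ᵥ p)
      have e1 : quad (b * k * bᵀ) p = p ⬝ᵥ b *ᵥ k *ᵥ b *ᵥ p := by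
        rw [hbs.eq, quad_eq, mulVec_mulVec, mulVec_mulVec]
      have e2 : quad (b * (k * b * k) * b) p = (k *ᵥ b *ᵥ p) ⬝ᵥ b *ᵥ k *ᵥ b *ᵥ p := by
        rw [quad_eq, ← mulVec_mulVec, ← mulVec_mulVec, ← mulVec_mulVec, ← mulVec_mulVec,
          dotProduct_mulVec_symm hbs, dotProduct_comm, dotProduct_mulVec_symm hk, dotProduct_comm]
      rw [e1, e2, quad_eq b p]
      exact h2
    rwa [hbs.eq] at this
  rw [trace_mul_PsiMat_sandwich hb hab hm] at hX
  have e3 : (b * (k * b * k)).trace = (b * k * b * k).trace := by simp only [mul_assoc]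
  have e4 : quad (k * b * k) h = (k *ᵥ h) ⬝ᵥ b *ᵥ (k *ᵥ h) := by
    rw [quad_eq, ← mulVec_mulVec, ← mulVec_mulVec, dotProduct_mulVec_symm hk, dotProduct_comm]
  rw [e3, e4] at hX
  have hC := sq_dotProduct_mulVec_le hb (a *ᵥ h) (k *ᵥ h)
  rw [dotProduct_mulVec_symm hbs, mulVec_inv hab, dotProduct_comm (k *ᵥ h), ← quad_eq,
    dotProduct_comm (a *ᵥ h) h, ← quad_eq] at hC
  rw [trace_mul_Lmat hb hab hm hk hk]
  have hθ : 0 ≤ (k *ᵥ h) ⬝ᵥ b *ᵥ (k *ᵥ h) := by rw [← quad_eq]; exact quad_nonneg hb _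
  revert hX
  set θ := (k *ᵥ h) ⬝ᵥ b *ᵥ (k *ᵥ h)
  set s := (b * k * b * k).trace
  set κ := (b * k).trace
  set X := (b * k * b * chiMat a b f k).trace
  intro hX
  set t := (a.det)⁻¹ with ht
  have ht0 : 0 < t := inv_pos.2 hdet
  have d1 : quad a h / a.det = t * quad a h := by rw [div_eq_inv_mul]
  have d2 : 2 / a.det = 2 * t := by rw [div_eq_mul_inv]
  have d4 : 4 / a.det = 4 * t := by rw [div_eq_mul_inv]
  rw [d1] at hH
  rw [d1, d4] at hX
  rw [d1, d2, d4]
  have hy : (t * quad k h) ^ 2 ≤ 1 / 2 * (t * θ) := by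
    calc (t * quad k h) ^ 2 = t ^ 2 * quad k h ^ 2 := by ring
      _ ≤ t ^ 2 * (quad a h * θ) := mul_le_mul_of_nonneg_left hC (by positivity)
      _ = (t * quad a h) * (t * θ) := by ring
      _ ≤ _ := mul_le_mul_of_nonneg_right hH (by positivity)
  have hq : 0 ≤ t * quad a h := mul_nonneg ht0.le (quad_nonneg ha h)
  have h5 : 0 ≤ (1 / 2 - t * quad a h) * s := mul_nonneg (by linarith) hs
  have h6 : 0 ≤ t * quad a h * κ ^ 2 := mul_nonneg hq (sq_nonneg _)
  -- From `6 t θ ≥ 12 y²`, the indefinite part is at least `κ²/2 - 4 κ y + 12 y² = (6 y - κ)²/3 +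
  -- κ²/6`.
  nlinarith [sq_nonneg (6 * (t * quad k h) - κ), sq_nonneg κ]

/-- The energy of a pair of symmetric matrices. -/
def energy (a b : Mat3) (f : Mom → ℝ) (h : Fin 3 → ℝ) (k Z k' Z' : Mat3) : ℝ :=
  (b * k * b * Lmat a b f h k').trace + (b * k * b * k').trace + 2 * (b * Z * b * Z').trace

theorem energy_pos (hf : IsDatum f) (ha : a.PosDef) (hb : b.PosDef) (hab : a * b = 1)
    (hm : MetricCond a b f h) {k Z : Mat3} (hk : k.IsSymm) (hZ : Z.IsSymm)
    (hne : k ≠ 0 ∨ Z ≠ 0) : 0 < energy a b f h k Z k Z := by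
  have h1 := trace_mul_Lmat_nonneg hf ha hb hab hm hk
  obtain ⟨h2, h3⟩ := trace_sq_nonneg hb hk
  obtain ⟨h4, h5⟩ := trace_sq_nonneg hb hZ
  rw [energy]
  rcases hne with hne | hne
  · have := lt_of_le_of_ne h2 fun e => hne (h3 e.symm)
    linarith
  · have := lt_of_le_of_ne h4 fun e => hne (h5 e.symm)
    linarith

theorem trace_sandwich_comm (b v k : Mat3) : (b * v * b * k).trace = (b * k * b * v).trace := by
  rw [mul_assoc (b * v), Matrix.trace_mul_comm, ← mul_assoc]

theorem energy_comm (hf : IsDatum f) (hb : b.PosDef) (hab : a * b = 1)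
    (hm : MetricCond a b f h) {k Z k' Z' : Mat3} (hk : k.IsSymm) (hk' : k'.IsSymm) :
    energy a b f h k Z k' Z' = energy a b f h k' Z' k Z := by
  rw [energy, energy, trace_mul_Lmat_comm hf hb hab hm hk hk', trace_sandwich_comm b k,
    trace_sandwich_comm b Z]

/-- The weight `2` on `Z` cancels the two cross terms in `⟨Lk, Z⟩`. With `tr(b Lk) = 2 tr(bk)` there
remains `2⟨k, Lk⟩ + 3 tr(bk)² + 2⟨k, k⟩ + 2⟨Z, Z⟩ - 2⟨k, Z⟩`, and the last three terms are `⟨k, k⟩ +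
⟨Z, Z⟩ + ⟨k - Z, k - Z⟩`. -/
theorem energy_accretive (hf : IsDatum f) (ha : a.PosDef) (hb : b.PosDef) (hab : a * b = 1)
    (hm : MetricCond a b f h) {k Z : Mat3} (hk : k.IsSymm) (hZ : Z.IsSymm) :
    (b * k * b * k).trace + (b * Z * b * Z).trace
      ≤ energy a b f h ((2 : ℝ) • k + tr b k • a - (2 : ℝ) • Z) (Lmat a b f h k + Z) k Z := by
  have h1 := trace_mul_Lmat_nonneg hf ha hb hab hm hk
  have h2 := trace_Lmat hf ha hb hab hm hk
  have hba : b * a * b = b := by rw [mul_eq_one_comm.1 hab, one_mul]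
  have h3 := trace_sandwich_comm b (Lmat a b f h k) Z
  have h4 := (trace_sq_nonneg hb (hk.sub hZ)).1
  have h5 := trace_sandwich_comm b Z k
  simp only [energy, mul_add, mul_sub, add_mul, sub_mul, smul_mul_assoc, mul_smul_comm, trace_add,
    trace_sub, trace_smul, smul_eq_mul, hba, h2, h3, tr_eq b hk] at h4 ⊢
  rw [h5] at h4 ⊢
  nlinarith [sq_nonneg (b * k).trace, (trace_sq_nonneg hb hk).1, (trace_sq_nonneg hb hZ).1]

end energy

/-! ### Smooth dependence of the coefficients on the metric. -/

/-- Components of a rank-two tensor, with the maximum norm. -/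
abbrev Comp := Fin 3 → Fin 3 → ℝ

theorem contDiffAt_clm_of_apply {D E F : Type*} [NormedAddCommGroup D] [NormedSpace ℝ D]
    [NormedAddCommGroup E] [NormedSpace ℝ E] [FiniteDimensional ℝ E] [NormedAddCommGroup F]
    [NormedSpace ℝ F] {f : D → E →L[ℝ] F} {x : D} (hf : ∀ y, ContDiffAt ℝ 1 (fun x => f x y) x) :
    ContDiffAt ℝ 1 f x := by
  let v := Module.finBasis ℝ E
  have e : f = fun x => ∑ i, (LinearMap.toContinuousLinearMap (v.coord i)).smulRight (f x (v i)) := by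
    ext x y
    have := congrArg (f x) (v.sum_repr y)
    simp only [map_sum, map_smul] at this
    simp [← this]
  rw [e]
  refine ContDiffAt.sum fun i _ => ?_
  exact ((ContinuousLinearMap.smulRightL ℝ E F
    (LinearMap.toContinuousLinearMap (v.coord i))).contDiff.contDiffAt).comp x (hf (v i))

/-- The components of the inverse metric. -/
def invC (a : Comp) : Comp := fun i j => (of a)⁻¹ i j

theorem contDiff_det : ContDiff ℝ 1 fun a : Comp => (of a).det := by
  simp only [det_fin_three, of_apply]
  fun_prop

theorem contDiffAt_inv_det {a : Comp} (ha : (of a).det ≠ 0) :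
    ContDiffAt ℝ 1 (fun a : Comp => ((of a).det)⁻¹) a :=
  contDiff_det.contDiffAt.inv ha

theorem contDiffAt_invC {a : Comp} (ha : (of a).det ≠ 0) : ContDiffAt ℝ 1 invC a := by
  refine contDiffAt_pi.2 fun i => contDiffAt_pi.2 fun j => ?_
  have e : (fun a : Comp => invC a i j) = fun a => ((of a).det)⁻¹ * (of a).adjugate i j := by
    ext a
    simp [invC, inv_def]
  rw [e]
  refine (contDiffAt_inv_det ha).mul ?_
  fin_cases i <;> fin_cases j <;> simp [adjugate_fin_three] <;> fun_prop

theorem continuous_quad_uncurry : Continuous fun x : Comp × Mom => quad (of x.1) x.2 := by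
  simp only [quad, of_apply]
  fun_prop

theorem isOpen_quad_pos {K : Set Mom} (hK : IsCompact K) :
    IsOpen {b : Comp | ∀ p ∈ K, 0 < quad (of b) p} := by
  rw [isOpen_iff_mem_nhds]
  intro b hb
  refine hK.eventually_forall_of_forall_eventually (P := fun b p => 0 < quad (of b) p)
    fun p hp => ?_
  exact continuous_quad_uncurry.continuousAt.eventually (lt_mem_nhds (hb p hp))

/-- By homogeneity the unit sphere suffices. Positivity on this compact set is an open condition on
components, so it persists for a short time. -/
theorem posDef_of_quad_pos {a : Mat3} (ha : a.IsSymm)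
    (h : ∀ p ∈ Metric.sphere (0 : Mom) 1, 0 < quad a p) : a.PosDef := by
  refine posDef_iff_dotProduct_mulVec.2 ⟨ha, fun x hx => ?_⟩
  have hn : ‖x‖ ≠ 0 := norm_ne_zero_iff.2 hx
  have h1 := h (‖x‖⁻¹ • x) (by simp [norm_smul, hn])
  have h2 : quad a (‖x‖⁻¹ • x) = ‖x‖⁻¹ ^ 2 * quad a x := by
    simp only [quad, Finset.mul_sum, Pi.smul_apply, smul_eq_mul]
    exact Finset.sum_congr rfl fun i _ => Finset.sum_congr rfl fun j _ => by ring
  rw [h2] at h1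
  have h3 := pos_of_mul_pos_right h1 (by positivity)
  rwa [star_trivial, ← quad_eq]

theorem IsDatum.contDiffAt_integral {f : Mom → ℝ} (hf : IsDatum f) (s : ℝ) {n : ℕ}
    (I : Fin n → Fin 3) {b : Comp} (hb : (of b).PosDef) :
    ContDiffAt ℝ 1 (fun b : Comp => ∫ p : Mom, quad (of b) p ^ s * (∏ s, p (I s)) * f p) b := by
  -- On `U` the base of the real power stays positive on the support of `f`, so the integrand is
  -- jointly `C¹`; off the support it is locally zero.
  set U : Set Comp := {b : Comp | ∀ p ∈ tsupport f, 0 < quad (of b) p} with hU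
  have hUo : IsOpen U := isOpen_quad_pos hf.compact
  have hbU : b ∈ U := fun p hp => quad_pos hb fun h0 => hf.support (h0 ▸ hp)
  have hq : ContDiff ℝ 1 fun x : Comp × Mom => quad (of x.1) x.2 := by
    simp only [quad, of_apply]
    fun_prop
  have hg : ContDiffOn ℝ 1 (fun x : Comp × Mom => quad (of x.1) x.2 ^ s * (∏ s, x.2 (I s)) * f x.2)
      (U ×ˢ univ) := by
    rintro ⟨c, p⟩ ⟨hc, -⟩
    by_cases hp : p ∈ tsupport f
    · refine ContDiffAt.contDiffWithinAt ?_
      refine ((hq.contDiffAt.rpow_const_of_ne (hc p hp).ne').mul ?_).mul ?_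
      · exact (contDiff_prod fun i _ => by fun_prop).contDiffAt
      · exact ((hf.smooth.of_le (by norm_cast)).contDiffAt).comp (c, p)
          contDiffAt_snd
    · refine ContDiffAt.contDiffWithinAt ?_
      have h0 : f =ᶠ[𝓝 p] 0 := notMem_tsupport_iff_eventuallyEq.1 hp
      have h1 : (fun x : Comp × Mom => quad (of x.1) x.2 ^ s * (∏ s, x.2 (I s)) * f x.2)
          =ᶠ[𝓝 (c, p)] fun _ => 0 := by
        have h2 : ∀ᶠ x : Comp × Mom in 𝓝 (c, p), f x.2 = 0 :=
          (continuousAt_snd (p := (c, p))).eventually h0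
        filter_upwards [h2] with x hx
        simp [hx]
      exact contDiffAt_const.congr_of_eventuallyEq h1
  -- The integral is the convolution of the constant `1` with the integrand, evaluated at the
  -- origin. This converts differentiation under the integral into smoothness of a parametrised
  -- convolution, up to the reflection `p ↦ -p`.
  have hconv := contDiffOn_convolution_right_with_param (𝕜 := ℝ) (μ := (volume : Measure Mom))
    (n := 1) (f := fun _ : Mom => (1 : ℝ)) (ContinuousLinearMap.mul ℝ ℝ)
    (g := fun (c : Comp) (p : Mom) => quad (of c) p ^ s * (∏ s, p (I s)) * f p)
    hUo hf.compact (fun c p _ hp => by simp [image_eq_zero_of_notMem_tsupport hp])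
    (locallyIntegrable_const 1) hg
  have h2 : ContDiffAt ℝ 1 (fun q : Comp × Mom => (convolution (fun _ : Mom => (1 : ℝ))
      (fun p => quad (of q.1) p ^ s * (∏ s, p (I s)) * f p) (ContinuousLinearMap.mul ℝ ℝ)
      volume) q.2) (b, 0) :=
    hconv.contDiffAt ((hUo.prod isOpen_univ).mem_nhds ⟨hbU, mem_univ _⟩)
  have h3 := h2.comp b (contDiffAt_id.prodMk (contDiffAt_const (c := (0 : Mom))))
  refine h3.congr_of_eventuallyEq (Filter.Eventually.of_forall fun c => ?_)
  simp only [Function.comp, convolution, ContinuousLinearMap.mul_apply', one_mul, zero_sub, id]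
  exact (integral_neg_eq_self (fun p : Mom => quad (of c) p ^ s * (∏ s, p (I s)) * f p) volume).symm

theorem IsDatum.contDiffAt_Psi {f : Mom → ℝ} (hf : IsDatum f) {n : ℕ}
    (I : Fin n → Fin 3) {a : Comp} (ha : (of a).PosDef) :
    ContDiffAt ℝ 1 (fun a : Comp => Psi (of a) (of (invC a)) f I) a := by
  have hd := ha.det_pos
  refine ContDiffAt.mul (contDiffAt_const.div (contDiff_det.contDiffAt.sqrt hd.ne') ?_) ?_
  · exact (Real.sqrt_pos.2 hd).ne'
  · have hb : (of (invC a)).PosDef := ha.inv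
    exact (hf.contDiffAt_integral _ I hb).comp a (contDiffAt_invC hd.ne')

/-! ### The Fuchsian operators on pairs of symmetric tensors. -/

/-- Pairs `(k, Z)` of symmetric tensors. -/
def symPairs : Submodule ℝ (Comp × Comp) where
  carrier := {y | (of y.1).IsSymm ∧ (of y.2).IsSymm}
  add_mem' := fun h h' => ⟨h.1.add h'.1, h.2.add h'.2⟩
  zero_mem' := ⟨isSymm_zero, isSymm_zero⟩
  smul_mem' := fun c _ h => ⟨h.1.smul c, h.2.smul c⟩

/-- The symmetric parts of a pair of tensors. -/
def symProj : Comp × Comp →L[ℝ] symPairs :=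
  LinearMap.toContinuousLinearMap
    { toFun := fun y => ⟨(fun i j => (y.1 i j + y.1 j i) / 2, fun i j => (y.2 i j + y.2 j i) / 2),
        by ext i j; simp [add_comm], by ext i j; simp [add_comm]⟩
      map_add' := fun y y' => by
        ext i j <;> simp <;> ring
      map_smul' := fun c y => by
        ext i j <;> simp <;> ring }

theorem symProj_of_mem {y : Comp × Comp} (hy : y ∈ symPairs) : symProj y = ⟨y, hy⟩ := by
  have h1 : ∀ i j, y.1 j i = y.1 i j := hy.1.apply
  have h2 : ∀ i j, y.2 j i = y.2 i j := hy.2.apply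
  ext i j <;> simp [symProj, h1, h2]

theorem chiMat_add (a b : Mat3) (f : Mom → ℝ) (k k' : Mat3) :
    chiMat a b f (k + k') = chiMat a b f k + chiMat a b f k' := by
  ext i j
  simp [chiMat, contr, mul_add, Finset.sum_add_distrib]

theorem chiMat_smul (a b : Mat3) (f : Mom → ℝ) (c : ℝ) (k : Mat3) :
    chiMat a b f (c • k) = c • chiMat a b f k := by
  ext i j
  simp only [chiMat, contr, Matrix.smul_apply, of_apply, smul_eq_mul, Finset.mul_sum]
  exact Finset.sum_congr rfl fun i _ => Finset.sum_congr rfl fun j _ => by ring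

theorem tr_add (b k k' : Mat3) : tr b (k + k') = tr b k + tr b k' := by
  simp [tr, mul_add, Finset.sum_add_distrib]

theorem tr_smul (b : Mat3) (c : ℝ) (k : Mat3) : tr b (c • k) = c * tr b k := by
  simp only [tr, Matrix.smul_apply, smul_eq_mul, Finset.mul_sum]
  exact Finset.sum_congr rfl fun i _ => Finset.sum_congr rfl fun j _ => by ring

theorem quad_add (k k' : Mat3) (h : Fin 3 → ℝ) : quad (k + k') h = quad k h + quad k' h := by
  simp [quad_eq, add_mulVec, dotProduct_add]

theorem quad_smul (c : ℝ) (k : Mat3) (h : Fin 3 → ℝ) : quad (c • k) h = c * quad k h := by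
  simp [quad_eq, smul_mulVec, dotProduct_smul]

theorem Lmat_add (a b : Mat3) (f : Mom → ℝ) (h : Fin 3 → ℝ) (k k' : Mat3) :
    Lmat a b f h (k + k') = Lmat a b f h k + Lmat a b f h k' := by
  simp only [Lmat, magMat, chiMat_add, tr_add, quad_add, add_mulVec]
  ext i j
  simp only [Matrix.add_apply, Matrix.sub_apply, Matrix.smul_apply, vecMulVec_apply, Pi.add_apply,
    smul_eq_mul]
  ring

theorem Lmat_smul (a b : Mat3) (f : Mom → ℝ) (h : Fin 3 → ℝ) (c : ℝ) (k : Mat3) :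
    Lmat a b f h (c • k) = c • Lmat a b f h k := by
  simp only [Lmat, magMat, chiMat_smul, tr_smul, quad_smul, smul_mulVec]
  ext i j
  simp only [Matrix.add_apply, Matrix.sub_apply, Matrix.smul_apply, vecMulVec_apply, Pi.smul_apply,
    smul_eq_mul]
  ring

/-- The singular part of the equations for `(k, Z)`. -/
def nLin (f : Mom → ℝ) (h : Fin 3 → ℝ) (a : Comp) : Comp × Comp →ₗ[ℝ] Comp × Comp where
  toFun y := ((2 : ℝ) • y.1 + tr (of (invC a)) (of y.1) • a - (2 : ℝ) • y.2,
    of.symm (Lmat (of a) (of (invC a)) f h (of y.1)) + y.2)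
  map_add' y y' := by
    have e : of (y.1 + y'.1) = of y.1 + of y'.1 := rfl
    refine Prod.ext ?_ ?_
    · simp only [Prod.fst_add, Prod.snd_add, e, tr_add, smul_add, add_smul]; abel
    · simp only [Prod.fst_add, Prod.snd_add, e, Lmat_add]
      ext i j
      simp; ring
  map_smul' c y := by
    have e : of (c • y.1) = c • of y.1 := rfl
    refine Prod.ext ?_ ?_
    · simp only [Prod.smul_fst, Prod.smul_snd, e, tr_smul, RingHom.id_apply, smul_add, smul_sub,
        mul_smul, smul_comm c (2 : ℝ)]
    · simp only [Prod.smul_fst, Prod.smul_snd, e, Lmat_smul]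
      ext i j
      simp; ring

/-- `nLin` as an operator on pairs of symmetric tensors. -/
def nOp (f : Mom → ℝ) (h : Fin 3 → ℝ) (a : Comp) : symPairs →L[ℝ] symPairs :=
  symProj ∘L LinearMap.toContinuousLinearMap (nLin f h a) ∘L symPairs.subtypeL

theorem contDiffAt_nLin {f : Mom → ℝ} (hf : IsDatum f) (h : Fin 3 → ℝ) {a : Comp}
    (ha : (of a).PosDef) (y : Comp × Comp) : ContDiffAt ℝ 1 (fun a => nLin f h a y) a := by
  obtain ⟨k, Z⟩ := y
  have hb : ContDiffAt ℝ 1 invC a := contDiffAt_invC ha.det_pos.ne'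
  have hb' : ∀ i j, ContDiffAt ℝ 1 (fun a => invC a i j) a := fun i j => by fun_prop
  have hdet := contDiffAt_inv_det ha.det_pos.ne'
  refine ContDiffAt.prodMk ?_ ?_
  · simp only [tr, of_apply]
    fun_prop
  · refine contDiffAt_pi.2 fun i => contDiffAt_pi.2 fun j => ?_
    have hP2 := hf.contDiffAt_Psi ![i, j] ha
    have hP4 : ∀ m n, ContDiffAt ℝ 1 (fun a => Psi (of a) (of (invC a)) f ![i, j, m, n]) a :=
      fun m n => hf.contDiffAt_Psi ![i, j, m, n] ha
    simp only [Pi.add_apply, of_symm_apply, Lmat, magMat, chiMat, contr, chiT, PsiMat, tr, quad,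
      Matrix.add_apply, Matrix.sub_apply, Matrix.smul_apply, smul_eq_mul, of_apply,
      vecMulVec_apply, mulVec, dotProduct, div_eq_mul_inv]
    refine ContDiffAt.add (ContDiffAt.sub (ContDiffAt.add (ContDiffAt.sub contDiffAt_const ?_) ?_)
      ?_) contDiffAt_const
    · refine ContDiffAt.sum fun p _ => ContDiffAt.sum fun q _ => ContDiffAt.mul ?_ contDiffAt_const
      exact ContDiffAt.sum fun m _ => ContDiffAt.sum fun n _ => ((hb' _ _).mul (hb' _ _)).mul
        (hP4 m n)
    · exact ContDiffAt.mul (by fun_prop) hP2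
    · exact ContDiffAt.mul (contDiffAt_const.mul hdet) (by fun_prop)

theorem contDiffAt_nOp {f : Mom → ℝ} (hf : IsDatum f) (h : Fin 3 → ℝ) {a : Comp}
    (ha : (of a).PosDef) : ContDiffAt ℝ 1 (nOp f h) a :=
  contDiffAt_clm_of_apply fun y =>
    (symProj.contDiff.contDiffAt).comp a (contDiffAt_nLin hf h ha y)

/-- The regular part of the equations for `(k, Z)`. -/
def gReg (Λ : ℝ) (x : ℝ × Comp × symPairs) : symPairs :=
  symProj (fun i j => -(tr (of (invC x.2.1)) (of x.2.2.1.1) / 2) * x.2.2.1.1 i j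
    + (∑ m, ∑ n, x.2.2.1.1 i m * invC x.2.1 m n * x.2.2.1.1 n j) + 2 * Λ * x.1 ^ 2 * x.2.1 i j, 0)

theorem contDiffAt_gReg (Λ τ : ℝ) {a : Comp} (ha : (of a).PosDef) (y : symPairs) :
    ContDiffAt ℝ 1 (gReg Λ) (τ, a, y) := by
  have hb : ContDiffAt ℝ 1 (fun x : ℝ × Comp × symPairs => invC x.2.1) (τ, a, y) :=
    ContDiffAt.comp (τ, a, y) (contDiffAt_invC ha.det_pos.ne')
      (contDiffAt_fst.comp (τ, a, y) contDiffAt_snd)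
  have hk : ContDiff ℝ 1 (fun x : ℝ × Comp × symPairs => x.2.2.1.1) :=
    (ContinuousLinearMap.fst ℝ Comp Comp ∘L symPairs.subtypeL ∘L
      ContinuousLinearMap.snd ℝ Comp symPairs ∘L
      ContinuousLinearMap.snd ℝ ℝ (Comp × symPairs)).contDiff
  refine (symProj.contDiff.contDiffAt).comp (τ, a, y) (ContDiffAt.prodMk ?_ contDiffAt_const)
  refine contDiffAt_pi.2 fun i => contDiffAt_pi.2 fun j => ?_
  simp only [tr, of_apply]
  have hb' : ∀ m n, ContDiffAt ℝ 1 (fun x : ℝ × Comp × symPairs => invC x.2.1 m n) (τ, a, y) :=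
    fun m n => contDiffAt_pi.1 (contDiffAt_pi.1 hb m) n
  have hk' : ∀ m n, ContDiffAt ℝ 1 (fun x : ℝ × Comp × symPairs => x.2.2.1.1 m n) (τ, a, y) :=
    fun m n => contDiffAt_pi.1 (contDiffAt_pi.1 hk.contDiffAt m) n
  refine ContDiffAt.add (ContDiffAt.add (ContDiffAt.mul (ContDiffAt.neg (ContDiffAt.div_const
    ?_ _)) (hk' i j)) ?_) (by fun_prop)
  · exact ContDiffAt.sum fun m _ => ContDiffAt.sum fun n _ => (hb' m n).mul (hk' m n)
  · exact ContDiffAt.sum fun m _ => ContDiffAt.sum fun n _ =>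
      ((hk' i m).mul (hb' m n)).mul (hk' n j)

theorem isSymm_Lmat {f : Mom → ℝ} {a b : Mat3} (ha : a.IsSymm) (h : Fin 3 → ℝ) {k : Mat3}
    (hk : k.IsSymm) : (Lmat a b f h k).IsSymm := by
  have h1 := IsDatum.isSymm_PsiMat (f := f) a b
  have h2 := IsDatum.isSymm_chiMat (f := f) a b k
  have h3 : (magMat a b h k).IsSymm := by
    simp only [IsSymm, magMat, transpose_add, transpose_sub, transpose_smul, transpose_vecMulVec,
      ha.eq, hk.eq]
    rw [add_comm (vecMulVec (k *ᵥ h) (a *ᵥ h))]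
  exact ((hk.sub h2).add (h1.smul _)).sub (h3.smul _)

theorem nLin_mem {f : Mom → ℝ} {a : Comp} (ha : (of a).IsSymm) (h : Fin 3 → ℝ) {y : Comp × Comp}
    (hy : y ∈ symPairs) : nLin f h a y ∈ symPairs := by
  have h1 : (of y.1).IsSymm := hy.1
  have h2 : (of y.2).IsSymm := hy.2
  exact ⟨((h1.smul (2 : ℝ)).add (ha.smul _)).sub (h2.smul (2 : ℝ)),
    (isSymm_Lmat ha h h1).add h2⟩

/-- Projecting defines the operator for every `a`, in a full neighbourhood of the initial metric;
for symmetric `a` the projection changes nothing. -/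
theorem coe_nOp {f : Mom → ℝ} {a : Comp} (ha : (of a).IsSymm) (h : Fin 3 → ℝ) (y : symPairs) :
    (nOp f h a y : Comp × Comp) = nLin f h a y := by
  have : nOp f h a y = symProj (nLin f h a y) := rfl
  rw [this, symProj_of_mem (nLin_mem ha h y.2)]

theorem coe_gReg (Λ : ℝ) {a : Comp} (ha : (of a).PosDef) (τ : ℝ) (y : symPairs) :
    (gReg Λ (τ, a, y) : Comp × Comp) = (fun i j => -(tr (of (invC a)) (of y.1.1) / 2) * y.1.1 i j
      + (∑ m, ∑ n, y.1.1 i m * invC a m n * y.1.1 n j) + 2 * Λ * τ ^ 2 * a i j, 0) := by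
  rw [gReg, symProj_of_mem]
  have h1 : ∀ i j, y.1.1 j i = y.1.1 i j := y.2.1.apply
  have h2 : ∀ i j, a j i = a i j := (isSymm_of_posDef ha).apply
  have h3 : ∀ i j, invC a j i = invC a i j := (isSymm_of_posDef ha.inv).apply
  refine ⟨?_, isSymm_zero⟩
  ext i j
  simp only [transpose_apply, of_apply]
  rw [h1 i j, h2 i j, Finset.sum_comm]
  congr 2
  refine Finset.sum_congr rfl fun m _ => Finset.sum_congr rfl fun n _ => ?_
  rw [h1 n j, h1 i m, h3 m n]
  ring

/-- The right-hand side of the equations for `(k, Z)`, in Fuchsian form. -/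
theorem coe_rhs (Λ : ℝ) {f : Mom → ℝ} (h : Fin 3 → ℝ) {a : Comp}
    (ha : (of a).PosDef) (τ : ℝ) (y : symPairs) :
    ((-(τ⁻¹ • nOp f h a y) + gReg Λ (τ, a, y) : symPairs) : Comp × Comp)
      = (kRHS Λ τ (of a) (of a)⁻¹ (of y.1.1) (of y.1.2),
        ZRHS τ h (of a) (of a)⁻¹ (of y.1.1) (of y.1.2) f) := by
  have hb : of (invC a) = (of a)⁻¹ := rfl
  have hk : (of y.1.1).IsSymm := y.2.1
  rw [Submodule.coe_add, Submodule.coe_neg, Submodule.coe_smul, coe_nOp (isSymm_of_posDef ha),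
    coe_gReg Λ ha]
  refine Prod.ext ?_ ?_
  · ext i j
    simp only [nLin, LinearMap.coe_mk, AddHom.coe_mk, Prod.fst_add, Prod.fst_neg, Prod.smul_fst,
      Pi.add_apply, Pi.neg_apply, Pi.smul_apply, Pi.sub_apply, smul_eq_mul, kRHS, contr_piT,
      of_apply, hb, invC]
    ring
  · ext i j
    simp only [nLin, LinearMap.coe_mk, AddHom.coe_mk, Prod.snd_add, Prod.snd_neg, Prod.smul_snd,
      Pi.add_apply, Pi.neg_apply, Pi.smul_apply, smul_eq_mul, ZRHS, contr_PiT, Pi.zero_apply,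
      contr_magBracket _ _ _ hk, of_apply, hb, Lmat, of_symm_apply, Matrix.add_apply,
      Matrix.sub_apply, Matrix.smul_apply, chiMat]
    ring

/-! ### The energy form and the vanishing of the initial `k` and `Z`. -/

/-- The energy as a bilinear form on pairs of symmetric tensors. -/
def energyForm (a : Mat3) (f : Mom → ℝ) (h : Fin 3 → ℝ) : symPairs →L[ℝ] symPairs →L[ℝ] ℝ :=
  LinearMap.toContinuousLinearMap (LinearMap.toContinuousLinearMap.toLinearMap ∘ₗ
    LinearMap.mk₂ ℝ
    (fun u v : symPairs => energy a a⁻¹ f h (of u.1.1) (of u.1.2) (of v.1.1) (of v.1.2))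
    (fun u u' v => by
      have e1 : of (u + u').1.1 = of u.1.1 + of u'.1.1 := rfl
      have e2 : of (u + u').1.2 = of u.1.2 + of u'.1.2 := rfl
      simp only [energy, e1, e2, mul_add, add_mul, trace_add]; ring)
    (fun c u v => by
      have e1 : of (c • u).1.1 = c • of u.1.1 := rfl
      have e2 : of (c • u).1.2 = c • of u.1.2 := rfl
      simp only [energy, e1, e2, mul_smul_comm, smul_mul_assoc, trace_smul, smul_eq_mul]; ring)
    (fun u v v' => by
      have e1 : of (v + v').1.1 = of v.1.1 + of v'.1.1 := rfl
      have e2 : of (v + v').1.2 = of v.1.2 + of v'.1.2 := rfl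
      simp only [energy, e1, e2, Lmat_add, mul_add, trace_add]; ring)
    (fun c u v => by
      have e1 : of (c • v).1.1 = c • of v.1.1 := rfl
      have e2 : of (c • v).1.2 = c • of v.1.2 := rfl
      simp only [energy, e1, e2, Lmat_smul, mul_smul_comm, trace_smul, smul_eq_mul]; ring))

theorem energyForm_apply (a : Mat3) (f : Mom → ℝ) (h : Fin 3 → ℝ) (u v : symPairs) :
    energyForm a f h u v
      = energy a a⁻¹ f h (of u.1.1) (of u.1.2) (of v.1.1) (of v.1.2) := rfl

theorem exists_coercive {E : Type*} [NormedAddCommGroup E] [NormedSpace ℝ E]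
    [FiniteDimensional ℝ E] (B : E →L[ℝ] E →L[ℝ] ℝ) (hB : ∀ u, u ≠ 0 → 0 < B u u) :
    ∃ c, 0 < c ∧ ∀ u, c * ‖u‖ ^ 2 ≤ B u u := by
  have hcont : Continuous fun u => B u u := B.continuous.clm_apply continuous_id
  rcases subsingleton_or_nontrivial E with hE | hE
  · exact ⟨1, one_pos, fun u => by simp [Subsingleton.elim u 0]⟩
  obtain ⟨x, hx, hmin⟩ := (isCompact_sphere (0 : E) 1).exists_isMinOn
    (NormedSpace.sphere_nonempty.2 zero_le_one) hcont.continuousOn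
  have hx0 : x ≠ 0 := fun h0 => by simp [h0] at hx
  refine ⟨B x x, hB x hx0, fun u => ?_⟩
  by_cases hu : u = 0
  · simp [hu]
  have hn : 0 < ‖u‖ := norm_pos_iff.2 hu
  have h1 : B x x ≤ B (‖u‖⁻¹ • u) (‖u‖⁻¹ • u) :=
    hmin (by simp [norm_smul, hn.ne'])
  simp only [map_smul, _root_.smul_apply, smul_eq_mul] at h1
  calc B x x * ‖u‖ ^ 2 ≤ ‖u‖⁻¹ * (‖u‖⁻¹ * B u u) * ‖u‖ ^ 2 := by gcongr
    _ = B u u := by field_simp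

theorem exists_isEnergy {f : Mom → ℝ} (hf : IsDatum f) {h : Fin 3 → ℝ} {a : Comp}
    (ha : (of a).PosDef) (hm : MetricCond (of a) (of a)⁻¹ f h) :
    ∃ c, Fuchsian.IsEnergy (nOp f h a) (energyForm (of a) f h) c := by
  have hb := ha.inv
  have hab : of a * (of a)⁻¹ = 1 := mul_nonsing_inv _ ha.det_pos.ne'.isUnit
  obtain ⟨c, hc, hco⟩ := exists_coercive (energyForm (of a) f h) fun u hu => by
    rw [energyForm_apply]
    refine energy_pos hf ha hb hab hm u.2.1 u.2.2 ?_
    by_contra hne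
    push Not at hne
    exact hu (Subtype.ext (Prod.ext hne.1 hne.2))
  refine ⟨c, fun u v => energy_comm hf hb hab hm u.2.1 v.2.1, hc, hco, fun u => ?_⟩
  have h1 := energy_accretive hf ha hb hab hm u.2.1 u.2.2
  have h2 := (trace_sq_nonneg hb u.2.1).1
  have h3 := (trace_sq_nonneg hb u.2.2).1
  rw [energyForm_apply, coe_nOp (isSymm_of_posDef ha)]
  exact (add_nonneg h2 h3).trans h1

theorem InitialData.b_eq_inv (D : InitialData) : D.b = D.a⁻¹ :=
  (inv_eq_right_inv D.a_mul_b).symm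

/-- The Fuchsian compatibility conditions force `k₀ = 0` and `Z₀ = 0`. -/
theorem InitialData.Fuchsian.eq_zero {D : InitialData} (hF : D.Fuchsian) : D.k = 0 ∧ D.Z = 0 := by
  have ha := D.a_posDef
  have hb : D.b.PosDef := D.b_eq_inv ▸ ha.inv
  have h1 : (2 : ℝ) • D.k + tr D.b D.k • D.a - (2 : ℝ) • D.Z = 0 := by
    ext i j
    have := hF.compat_k i j
    rw [contr_deltaT D.k_symm, contr_deltaT D.Z_symm, contr_piT] at this
    simp only [Matrix.add_apply, Matrix.sub_apply, Matrix.smul_apply, smul_eq_mul,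
      Matrix.zero_apply]
    linarith
  have h2 : Lmat D.a D.b D.f D.h D.k + D.Z = 0 := by
    ext i j
    have := hF.compat_Z i j
    rw [contr_deltaT D.k_symm, contr_deltaT D.Z_symm, contr_PiT, contr_magT D.h
      (isSymm_of_posDef ha) (isSymm_of_posDef hb) D.a_mul_b D.k_symm] at this
    simp only [Lmat, chiMat, Matrix.add_apply, Matrix.sub_apply, Matrix.smul_apply, smul_eq_mul,
      Matrix.zero_apply, of_apply]
    linarith
  -- The compatibility conditions say `N(a₀)(k₀, Z₀) = 0`, so the energy on the right vanishes and
  -- both traces on the left must be zero.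
  have h3 := energy_accretive D.isDatum ha hb D.a_mul_b hF.metricCond D.k_symm D.Z_symm
  rw [h1, h2] at h3
  have h4 : energy D.a D.b D.f D.h 0 0 D.k D.Z = 0 := by simp [energy]
  rw [h4] at h3
  obtain ⟨h5, h6⟩ := trace_sq_nonneg hb D.k_symm
  obtain ⟨h7, h8⟩ := trace_sq_nonneg hb D.Z_symm
  exact ⟨h6 (by linarith), h8 (by linarith)⟩

/-! ### From the Fuchsian system to the Einstein-Vlasov system. -/

theorem Psi_congr {f g : Mom → ℝ} (hfg : f =ᵐ[volume] g) (a b : Mat3) {n : ℕ} (I : Fin n → Fin 3) :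
    Psi a b f I = Psi a b g I := by
  rw [Psi, Psi]
  congr 1
  refine integral_congr_ae ?_
  filter_upwards [hfg] with p hp
  rw [hp]

theorem ZRHS_congr {f g : Mom → ℝ} (hfg : f =ᵐ[volume] g) (τ : ℝ) (h : Fin 3 → ℝ)
    (a b k Z : Mat3) : ZRHS τ h a b k Z f = ZRHS τ h a b k Z g := by
  ext i j
  simp only [ZRHS, contr, chiT, PiT, Psi_congr hfg]

/-- Positive definite tensors. -/
def posSet : Set Comp := {a | (of a).PosDef}

/-- The projection `(k, Z) ↦ k`. -/
def kProj : symPairs →L[ℝ] Comp := ContinuousLinearMap.fst ℝ Comp Comp ∘L symPairs.subtypeL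

/-- The Fuchsian system that is equivalent to the rescaled Einstein-Vlasov system. -/
abbrev IsFuchsianSol (Λ : ℝ) (D : InitialData) (T : ℝ) (a : ℝ → Comp) (y : ℝ → symPairs) : Prop :=
  Fuchsian.IsSol (nOp D.f D.h) (gReg Λ) kProj (of.symm D.a) T a y

/-- The regular part is quadratic in `k`, apart from the cosmological term with its factor `τ²`.
This vanishing is what makes `y` quadratically small at `τ = 0`. -/
theorem gReg_zero (Λ : ℝ) (a : Comp) : gReg Λ (0, a, 0) = 0 := by
  have : (fun i j => -(tr (of (invC a)) (of (0 : symPairs).1.1) / 2) * (0 : symPairs).1.1 i j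
    + (∑ m, ∑ n, (0 : symPairs).1.1 i m * invC a m n * (0 : symPairs).1.1 n j)
    + 2 * Λ * (0 : ℝ) ^ 2 * a i j : Comp) = 0 := by
    ext i j; simp
  simp only [gReg]
  rw [this]
  exact map_zero symProj

theorem hasDerivWithinAt_comp_iff {f : ℝ → Comp} {f' : Comp} {s : Set ℝ} {τ : ℝ} :
    HasDerivWithinAt f f' s τ ↔ ∀ i j, HasDerivWithinAt (fun t => f t i j) (f' i j) s τ := by
  simp only [hasDerivWithinAt_pi]

theorem coe_hasDerivWithinAt {y : ℝ → symPairs} {y' : symPairs} {s : Set ℝ} {τ : ℝ}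
    (h : HasDerivWithinAt y y' s τ) :
    (∀ i j, HasDerivWithinAt (fun t => (y t).1.1 i j) (y'.1.1 i j) s τ) ∧
      ∀ i j, HasDerivWithinAt (fun t => (y t).1.2 i j) (y'.1.2 i j) s τ := by
  have h1 : HasDerivWithinAt (fun t => ((y t : Comp × Comp))) (y' : Comp × Comp) s τ :=
    (symPairs.subtypeL.hasFDerivAt (x := y τ)).comp_hasDerivWithinAt τ h
  exact ⟨hasDerivWithinAt_comp_iff.1 h1.fst, hasDerivWithinAt_comp_iff.1 h1.snd⟩

theorem exists_isFuchsianSol (Λ : ℝ) {D : InitialData} (hF : D.Fuchsian) :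
    ∃ T, 0 < T ∧ ∃ a y, IsFuchsianSol Λ D T a y ∧ (∀ τ ∈ Icc 0 T, a τ ∈ posSet) ∧
      ∃ M, ∀ τ ∈ Icc 0 T, ‖y τ‖ ≤ M * τ ^ 2 := by
  have ha : (of (of.symm D.a)).PosDef := D.a_posDef
  have hm := hF.metricCond
  rw [D.b_eq_inv] at hm
  obtain ⟨c, hc⟩ := exists_isEnergy D.isDatum ha hm
  have hU := (isOpen_quad_pos (isCompact_sphere (0 : Mom) 1)).mem_nhds
    (x := of.symm D.a) fun p hp => quad_pos ha fun h0 => by simp [h0] at hp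
  obtain ⟨T, hT, a, y, hs, haU, hM⟩ := Fuchsian.exists_isSol (P := kProj)
    (contDiffAt_nOp D.isDatum D.h ha) (contDiffAt_gReg Λ 0 ha 0) (gReg_zero Λ _) hc hU
  refine ⟨T, hT, a, y, hs, fun τ hτ => posDef_of_quad_pos ?_ (haU τ hτ), hM⟩
  -- The neighbourhood controls only positivity. Symmetry follows because `a j i - a i j` has
  -- derivative `k j i - k i j = 0` and vanishes initially.
  ext i j
  have h0 : ∀ t, (y t).1.1 j i = (y t).1.1 i j := fun t => (y t).2.1.apply i j
  have h1 := Fuchsian.norm_le_of_hasDerivWithinAt (T := T) (f := fun t => a t j i - a t i j)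
    (f' := fun _ => 0) (M := 0) ?_ ?_ continuousOn_const ?_ hτ (by simp)
  · rw [zero_mul, norm_le_zero_iff] at h1
    exact sub_eq_zero.1 h1
  · have := hs.a_cont
    exact (continuousOn_pi.1 (continuousOn_pi.1 this j) i).sub
      (continuousOn_pi.1 (continuousOn_pi.1 this i) j)
  · simp only [hs.a_zero]
    exact sub_eq_zero.2 ((isSymm_of_posDef D.a_posDef).apply i j)
  · intro t ht
    have h2 := hasDerivWithinAt_comp_iff.1 (hs.a_deriv t ht)
    refine ((h2 j i).fun_sub (h2 i j)).congr_deriv ?_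
    exact sub_eq_zero.2 (h0 t)

/-- Differentiating `a b = 1` and multiplying by `b` gives `b' = -b k b`. -/
theorem hasDerivWithinAt_invC {T : ℝ} (hT : 0 < T) {a : ℝ → Comp} {k : Comp}
    (ha : ∀ τ ∈ Icc 0 T, a τ ∈ posSet) {τ : ℝ} (hτ : τ ∈ Icc 0 T)
    (hd : HasDerivWithinAt a k (Icc 0 T) τ) (i j : Fin 3) :
    HasDerivWithinAt (fun t => invC (a t) i j)
      (-∑ m, ∑ n, invC (a τ) i m * invC (a τ) j n * k m n) (Icc 0 T) τ := by
  have hdet : ∀ t ∈ Icc 0 T, (of (a t)).det ≠ 0 := fun t ht => (ha t ht).det_pos.ne'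
  have hb : HasDerivWithinAt (fun t => invC (a t)) (fderiv ℝ invC (a τ) k) (Icc 0 T) τ :=
    (((contDiffAt_invC (hdet τ hτ)).differentiableAt one_ne_zero).hasFDerivAt).comp_hasDerivWithinAt
      τ hd
  set B : Comp := fderiv ℝ invC (a τ) k
  have hmul : ∀ t ∈ Icc 0 T, of (a t) * of (invC (a t)) = 1 := fun t ht =>
    mul_nonsing_inv _ (hdet t ht).isUnit
  have key : of k * of (invC (a τ)) + of (a τ) * of B = 0 := by
    ext i j
    have h1 : HasDerivWithinAt (fun t => ∑ l, a t i l * invC (a t) l j)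
        (∑ l, (k i l * invC (a τ) l j + a τ i l * B l j)) (Icc 0 T) τ :=
      HasDerivWithinAt.fun_sum fun l _ => (hasDerivWithinAt_comp_iff.1 hd i l).mul
        (hasDerivWithinAt_comp_iff.1 hb l j)
    have h2 : HasDerivWithinAt (fun t => ∑ l, a t i l * invC (a t) l j) 0 (Icc 0 T) τ := by
      refine (hasDerivWithinAt_const τ (Icc 0 T) ((1 : Mat3) i j)).congr_of_mem (fun t ht => ?_) hτ
      rw [← hmul t ht]
      rfl
    have h3 := (uniqueDiffOn_Icc hT τ hτ).eq_deriv _ h1 h2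
    rw [Finset.sum_add_distrib] at h3
    simpa [Matrix.mul_apply] using h3
  have hBm : of B = -(of (invC (a τ)) * of k * of (invC (a τ))) := by
    have h4 : of (a τ) * of B = -(of k * of (invC (a τ))) := by
      rw [eq_neg_iff_add_eq_zero, add_comm]; exact key
    calc of B = (of (invC (a τ)) * of (a τ)) * of B := by
          rw [mul_eq_one_comm.1 (hmul τ hτ), one_mul]
      _ = _ := by rw [mul_assoc, h4, mul_neg, mul_assoc]
  refine (hasDerivWithinAt_comp_iff.1 hb i j).congr_deriv ?_
  have h5 : B i j = (of B) i j := rfl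
  have h6 : ∀ n, invC (a τ) n j = invC (a τ) j n := fun n =>
    (isSymm_of_posDef (ha τ hτ).inv).apply j n
  rw [h5, hBm]
  simp only [Matrix.neg_apply, Matrix.mul_apply, of_apply, Finset.sum_mul, h6]
  rw [Finset.sum_comm]
  congr 1
  exact Finset.sum_congr rfl fun m _ => Finset.sum_congr rfl fun n _ => by ring

theorem InitialData.memLp (D : InitialData) : MemLp D.f 1 (volume : Measure Mom) :=
  memLp_one_iff_integrable.2 (D.f_smooth.continuous.integrable_of_hasCompactSupport D.f_compact)

/-- The curve of unknowns that belongs to a solution of the Fuchsian system. -/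
def toCurve (D : InitialData) (a : ℝ → Comp) (y : ℝ → symPairs) : Curve where
  a τ := of (a τ)
  b τ := (of (a τ))⁻¹
  k τ := of (y τ).1.1
  Z τ := of (y τ).1.2
  f _ := D.memLp.toLp

theorem IsFuchsianSol.isSolution {Λ : ℝ} {D : InitialData} (hF : D.Fuchsian) {T : ℝ} (hT : 0 < T)
    {a : ℝ → Comp} {y : ℝ → symPairs} (h : IsFuchsianSol Λ D T a y)
    (ha : ∀ τ ∈ Icc 0 T, a τ ∈ posSet) : IsSolution Λ D T (toCurve D a y) := by
  have hy : ContinuousOn (fun τ => ((y τ : Comp × Comp))) (Icc 0 T) :=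
    symPairs.subtypeL.continuous.comp_continuousOn h.y_cont
  have hae : (D.memLp.toLp : Mom → ℝ) =ᵐ[volume] D.f := D.memLp.coeFn_toLp
  have hrhs : ∀ τ ∈ Ioc 0 T, _ := fun τ hτ => coe_hasDerivWithinAt (h.y_deriv τ hτ)
  exact
    { a_cont := h.a_cont
      b_cont := fun τ hτ => ((contDiffAt_invC (ha τ hτ).det_pos.ne').continuousAt
        ).comp_continuousWithinAt (h.a_cont τ hτ)
      k_cont := continuous_fst.comp_continuousOn hy
      Z_cont := continuous_snd.comp_continuousOn hy
      a_posDef := ha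
      b_symm := fun τ hτ => isSymm_of_posDef (ha τ hτ).inv
      k_symm := fun τ _ => (y τ).2.1
      Z_symm := fun τ _ => (y τ).2.2
      f_contDiff := contDiffOn_const
      a_init := h.a_zero
      b_init := by
        have : (toCurve D a y).b 0 = (of (a 0))⁻¹ := rfl
        rw [this, h.a_zero, D.b_eq_inv]; rfl
      k_init := by
        have : (toCurve D a y).k 0 = of (y 0).1.1 := rfl
        rw [this, h.y_zero, hF.eq_zero.1]; rfl
      Z_init := by
        have : (toCurve D a y).Z 0 = of (y 0).1.2 := rfl
        rw [this, h.y_zero, hF.eq_zero.2]; rfl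
      f_init := hae
      a_eq := fun τ hτ => hasDerivWithinAt_comp_iff.1 (h.a_deriv τ hτ)
      b_eq := fun τ hτ =>
        hasDerivWithinAt_invC hT ha ⟨hτ.1.le, hτ.2⟩ (h.a_deriv τ hτ)
      k_eq := fun τ hτ i j => by
        have h1 := (hrhs τ hτ).1 i j
        rw [coe_rhs Λ D.h (ha τ ⟨hτ.1.le, hτ.2⟩) τ (y τ)] at h1
        exact h1
      Z_eq := fun τ hτ i j => by
        have h1 := (hrhs τ hτ).2 i j
        rw [coe_rhs Λ D.h (ha τ ⟨hτ.1.le, hτ.2⟩) τ (y τ), ← ZRHS_congr hae] at h1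
        exact h1
      f_eq := fun τ _ => hasDerivWithinAt_const _ _ _ }

theorem IsFuchsianSol.isC1On {Λ : ℝ} {D : InitialData} {T : ℝ} (hT : 0 < T)
    {a : ℝ → Comp} {y : ℝ → symPairs} (h : IsFuchsianSol Λ D T a y)
    (ha : ∀ τ ∈ Icc 0 T, a τ ∈ posSet) {M : ℝ} (hM : ∀ τ ∈ Icc 0 T, ‖y τ‖ ≤ M * τ ^ 2) :
    IsC1On (toCurve D a y).a T ∧ IsC1On (toCurve D a y).b T ∧
      IsC1On (toCurve D a y).k T ∧ IsC1On (toCurve D a y).Z T := by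
  have h1 : ContDiffOn ℝ 1 a (Icc 0 T) := h.contDiffOn_a hT
  have h2 : ContDiffOn ℝ 1 y (Icc 0 T) := h.contDiffOn_y hT
    (fun τ hτ => (contDiffAt_nOp D.isDatum D.h (ha τ hτ)).continuousAt)
    (fun τ hτ => (contDiffAt_gReg Λ τ (ha τ hτ) (y τ)).continuousAt) hM
  have h3 : ContDiffOn ℝ 1 (fun τ => ((y τ : Comp × Comp))) (Icc 0 T) :=
    symPairs.subtypeL.contDiff.comp_contDiffOn h2
  have h4 : ContDiffOn ℝ 1 (fun τ => invC (a τ)) (Icc 0 T) := fun τ hτ =>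
    (contDiffAt_invC (ha τ hτ).det_pos.ne').comp_contDiffWithinAt τ (h1 τ hτ)
  exact ⟨fun i j => contDiffOn_pi.1 (contDiffOn_pi.1 h1 i) j,
    fun i j => contDiffOn_pi.1 (contDiffOn_pi.1 h4 i) j,
    fun i j => contDiffOn_pi.1 (contDiffOn_pi.1 (contDiff_fst.comp_contDiffOn h3) i) j,
    fun i j => contDiffOn_pi.1 (contDiffOn_pi.1 (contDiff_snd.comp_contDiffOn h3) i) j⟩

/-! ### From the Einstein-Vlasov system back to the Fuchsian system. -/

namespace IsSolution

variable {Λ : ℝ} {D : InitialData} {T : ℝ} {S : Curve}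

theorem f_eq_const (h : IsSolution Λ D T S) : ∀ τ ∈ Icc 0 T, S.f τ = D.memLp.toLp := by
  have h0 : S.f 0 = D.memLp.toLp :=
    Lp.ext (h.f_init.trans D.memLp.coeFn_toLp.symm)
  intro τ hτ
  rw [← h0]
  refine constant_of_has_deriv_right_zero h.f_contDiff.continuousOn (fun t ht => ?_) τ hτ
  exact (h.f_eq t ⟨ht.1, ht.2.le⟩).mono_of_mem_nhdsWithin (Icc_mem_nhdsGE_of_mem ht)

theorem norm_mul_le_three (X Y : Comp) : ‖of.symm (of X * of Y)‖ ≤ 3 * ‖Y‖ * ‖X‖ := by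
  refine (pi_norm_le_iff_of_nonneg (by positivity)).2 fun i =>
    (pi_norm_le_iff_of_nonneg (by positivity)).2 fun j => ?_
  simp only [of_symm_apply, Matrix.mul_apply, of_apply]
  have h1 : ∀ (Z : Comp) i j, ‖Z i j‖ ≤ ‖Z‖ := fun Z i j =>
    (norm_le_pi_norm (Z i) j).trans (norm_le_pi_norm Z i)
  refine (norm_sum_le_of_le _ fun l _ => ?_).trans (le_of_eq (?_ : ∑ _l : Fin 3, ‖X‖ * ‖Y‖ = _))
  · rw [norm_mul]
    exact mul_le_mul (h1 X i l) (h1 Y l j) (norm_nonneg _) (norm_nonneg _)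
  · simp; ring

/-- The defect `F = a b - 1` solves the linear equation `F' = -F (k b)` with `F 0 = 0`. Since `k b`
is bounded on `[0, T]`, Grönwall's inequality gives `F = 0`. -/
theorem a_mul_b (h : IsSolution Λ D T S) (hT : 0 < T) :
    ∀ τ ∈ Icc 0 T, S.a τ * S.b τ = 1 := by
  have hac : ∀ i j, ContinuousOn (fun τ => S.a τ i j) (Icc 0 T) := fun i j =>
    continuousOn_pi.1 (continuousOn_pi.1 h.a_cont i) j
  have hbc : ∀ i j, ContinuousOn (fun τ => S.b τ i j) (Icc 0 T) := fun i j =>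
    continuousOn_pi.1 (continuousOn_pi.1 h.b_cont i) j
  have hkc : ∀ i j, ContinuousOn (fun τ => S.k τ i j) (Icc 0 T) := fun i j =>
    continuousOn_pi.1 (continuousOn_pi.1 h.k_cont i) j
  set F : ℝ → Comp := fun τ => of.symm (S.a τ * S.b τ - 1) with hFdef
  set X : ℝ → Comp := fun τ => of.symm (S.k τ * S.b τ) with hX
  set F' : ℝ → Comp := fun τ => -of.symm (of (F τ) * of (X τ)) with hF'
  have hFc : ContinuousOn F (Icc 0 T) := by
    refine continuousOn_pi.2 fun i => continuousOn_pi.2 fun j => ?_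
    simp only [hFdef, of_symm_apply, Matrix.sub_apply, Matrix.mul_apply]
    exact (continuousOn_finsetSum _ fun l _ => (hac i l).mul (hbc l j)).sub continuousOn_const
  have hXc : ContinuousOn X (Icc 0 T) := by
    refine continuousOn_pi.2 fun i => continuousOn_pi.2 fun j => ?_
    simp only [hX, of_symm_apply, Matrix.mul_apply]
    exact continuousOn_finsetSum _ fun l _ => (hkc i l).mul (hbc l j)
  have hF'c : ContinuousOn F' (Icc 0 T) := by
    refine continuousOn_pi.2 fun i => continuousOn_pi.2 fun j => ?_
    simp only [hF', Pi.neg_apply, of_symm_apply, Matrix.mul_apply, of_apply]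
    exact (continuousOn_finsetSum _ fun l _ =>
      (continuousOn_pi.1 (continuousOn_pi.1 hFc i) l).mul
        (continuousOn_pi.1 (continuousOn_pi.1 hXc l) j)).neg
  have hd : ∀ τ ∈ Ioc 0 T, HasDerivWithinAt F (F' τ) (Icc 0 T) τ := by
    intro τ hτ
    refine hasDerivWithinAt_comp_iff.2 fun i j => ?_
    have h1 : HasDerivWithinAt (fun t => ∑ l, S.a t i l * S.b t l j - (1 : Mat3) i j) _
        (Icc 0 T) τ :=
      (HasDerivWithinAt.fun_sum fun l _ => (h.a_eq τ hτ i l).mul (h.b_eq τ hτ l j)).sub_const _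
    refine h1.congr_deriv ?_
    have hbs := h.b_symm τ ⟨hτ.1.le, hτ.2⟩
    have e : F' τ i j = (S.k τ * S.b τ - S.a τ * (S.b τ * S.k τ * S.b τ)) i j := by
      have : F' τ i j = (-((S.a τ * S.b τ - 1) * (S.k τ * S.b τ))) i j := rfl
      rw [this]
      refine congrArg (fun M : Mat3 => M i j) ?_
      rw [sub_mul, one_mul, neg_sub]
      simp only [mul_assoc]
    have h2 : ∀ l, ∑ m, ∑ n, S.b τ l m * S.b τ j n * S.k τ m n
        = (S.b τ * S.k τ * S.b τ) l j := fun l => by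
      simp only [Matrix.mul_apply, Finset.sum_mul]
      rw [Finset.sum_comm]
      refine Finset.sum_congr rfl fun n _ => Finset.sum_congr rfl fun m _ => ?_
      rw [hbs.apply j n]; ring
    rw [e, Matrix.sub_apply, Matrix.mul_apply, Matrix.mul_apply, ← Finset.sum_sub_distrib]
    exact Finset.sum_congr rfl fun l _ => by rw [h2]; ring
  have hd' := Fuchsian.hasDerivWithinAt_Icc_of_Ioc hT hFc hF'c hd
  obtain ⟨R, hR⟩ := isCompact_Icc.exists_bound_of_continuousOn hXc
  intro τ hτ
  have hF0 : F 0 = 0 := by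
    simp only [hFdef, h.a_init, h.b_init, D.a_mul_b, sub_self]
    rfl
  have h3 := norm_le_gronwallBound_of_norm_deriv_right_le (f' := F') (δ := 0) (K := 3 * R)
    (ε := 0) hFc (fun t ht => (hd' t ⟨ht.1, ht.2.le⟩).mono_of_mem_nhdsWithin
      (Icc_mem_nhdsGE_of_mem ht)) (by simp [hF0]) (fun t ht => by
        rw [add_zero, hF', norm_neg]
        refine (norm_mul_le_three _ _).trans ?_
        have := hR t ⟨ht.1, ht.2.le⟩
        gcongr) τ hτ
  rw [gronwallBound_ε0_δ0, norm_le_zero_iff] at h3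
  exact sub_eq_zero.1 h3

theorem b_eq_inv (h : IsSolution Λ D T S) (hT : 0 < T) {τ : ℝ} (hτ : τ ∈ Icc 0 T) :
    S.b τ = (S.a τ)⁻¹ := (inv_eq_right_inv (h.a_mul_b hT τ hτ)).symm

theorem symPairs_mem (h : IsSolution Λ D T S) {τ : ℝ} (hτ : τ ∈ Icc 0 T) :
    (of.symm (S.k τ), of.symm (S.Z τ)) ∈ symPairs := ⟨h.k_symm τ hτ, h.Z_symm τ hτ⟩

theorem isFuchsianSol (h : IsSolution Λ D T S) (hF : D.Fuchsian) (hT : 0 < T) :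
    IsFuchsianSol Λ D T (fun τ => of.symm (S.a τ))
      (fun τ => symProj (of.symm (S.k τ), of.symm (S.Z τ))) where
  a_cont := h.a_cont
  y_cont := symProj.continuous.comp_continuousOn (h.k_cont.prodMk h.Z_cont)
  a_zero := congrArg of.symm h.a_init
  y_zero := by
    rw [h.k_init, h.Z_init, hF.eq_zero.1, hF.eq_zero.2]
    exact map_zero symProj
  a_deriv := fun τ hτ => by
    rw [symProj_of_mem (h.symPairs_mem ⟨hτ.1.le, hτ.2⟩)]
    exact hasDerivWithinAt_comp_iff.2 (h.a_eq τ hτ)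
  y_deriv := fun τ hτ => by
    have hτ' : τ ∈ Icc 0 T := ⟨hτ.1.le, hτ.2⟩
    have hae : (S.f τ : Mom → ℝ) =ᵐ[volume] D.f := by
      rw [h.f_eq_const τ hτ']; exact D.memLp.coeFn_toLp
    have h1 : HasDerivWithinAt (fun t => ((of.symm (S.k t), of.symm (S.Z t)) : Comp × Comp))
        (kRHS Λ τ (S.a τ) (S.b τ) (S.k τ) (S.Z τ),
          ZRHS τ D.h (S.a τ) (S.b τ) (S.k τ) (S.Z τ) (S.f τ)) (Icc 0 T) τ :=
      (hasDerivWithinAt_comp_iff.2 (h.k_eq τ hτ)).prodMk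
        (hasDerivWithinAt_comp_iff.2 (h.Z_eq τ hτ))
    refine ((symProj.hasFDerivAt).comp_hasDerivWithinAt τ h1).congr_deriv ?_
    have h2 := coe_rhs Λ (f := D.f) D.h (a := of.symm (S.a τ)) (h.a_posDef τ hτ') τ
      (symProj (of.symm (S.k τ), of.symm (S.Z τ)))
    rw [ZRHS_congr hae, h.b_eq_inv hT hτ']
    set r := -(τ⁻¹ • nOp D.f D.h (of.symm (S.a τ)) (symProj (of.symm (S.k τ), of.symm (S.Z τ))))
      + gReg Λ (τ, of.symm (S.a τ), symProj (of.symm (S.k τ), of.symm (S.Z τ))) with hr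
    -- The right-hand side already lies in `symPairs`, so differentiating through the projection
    -- leaves it unchanged.
    have h3 : symProj (r : Comp × Comp) = r := symProj_of_mem r.2
    rw [← h3, h2, symProj_of_mem (h.symPairs_mem hτ')]
    rfl

theorem agreeOn (h : IsSolution Λ D T S) {S' : Curve} (h' : IsSolution Λ D T S')
    (hF : D.Fuchsian) (hT : 0 < T) : S'.AgreeOn S T := by
  have ha : (of (of.symm D.a)).PosDef := D.a_posDef
  have hm := hF.metricCond
  rw [D.b_eq_inv] at hm
  obtain ⟨c, hc⟩ := exists_isEnergy D.isDatum ha hm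
  have hu := Fuchsian.IsSol.unique hc (S := posSet)
    (fun a ha => contDiffAt_nOp D.isDatum D.h ha) (fun τ a ha y => contDiffAt_gReg Λ τ ha y)
    (h'.isFuchsianSol hF hT) (h.isFuchsianSol hF hT) h'.a_posDef h.a_posDef
  intro τ hτ
  obtain ⟨h1, h2⟩ := hu τ hτ
  rw [symProj_of_mem (h'.symPairs_mem hτ), symProj_of_mem (h.symPairs_mem hτ)] at h2
  have h3 := congrArg Subtype.val h2
  have h4 : S'.a τ = S.a τ := h1
  exact ⟨h4, by rw [h'.b_eq_inv hT hτ, h.b_eq_inv hT hτ, h4], congrArg Prod.fst h3,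
    congrArg Prod.snd h3, by rw [h'.f_eq_const τ hτ, h.f_eq_const τ hτ]⟩

end IsSolution

end RescaledEV

end

theorem mainTheorem3 (Λ : ℝ) (D : RescaledEV.InitialData)
    (hF : D.Fuchsian) (hC : D.Constraints) :
    ∃ T : ℝ, 0 < T ∧ ∃ S : RescaledEV.Curve,
      RescaledEV.IsSolution Λ D T S ∧
      (∀ τ ∈ Set.Icc 0 T, S.a τ * S.b τ = 1) ∧
      (∀ S' : RescaledEV.Curve, RescaledEV.IsSolution Λ D T S' → S'.AgreeOn S T) ∧
      (RescaledEV.quad D.a D.h < 1 / 6 ∨ RescaledEV.quad D.a D.h < D.a.det / 6 →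
        RescaledEV.IsC1On S.a T ∧ RescaledEV.IsC1On S.b T ∧
        RescaledEV.IsC1On S.k T ∧ RescaledEV.IsC1On S.Z T) := by
  obtain ⟨T, hT, a, y, hs, ha, M, hM⟩ := RescaledEV.exists_isFuchsianSol Λ hF
  have h := hs.isSolution hF hT ha
  exact ⟨T, hT, RescaledEV.toCurve D a y, h, h.a_mul_b hT, fun S' h' => h.agreeOn h' hF hT,
    fun _ => hs.isC1On hT ha hM⟩
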